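/- **Setting.** Closed balls are used throughout. The doubling constant of a metric space $(X,\mathcal D)$ is the least $N$ such that every ball of radius $r>0$ is covered by $N$ balls of radius $r/2$; $X$ is doubling if $N<\infty$, and its doubling dimension is $d=\log_2 N$. A function $f:X\to\mathbb R$ is nondegenerate with parameters $L\ge\lambda>0$, $q\ge1$ if it has a unique minimiser $x^*$ and $\lambda\,\mathcal D(x,x^*)^q\le f(x)-f(x^*)\le L\,\mathcal D(x,x^*)^q$ for all $x\in X$. Playing $x_t$ at step $t$ produces the loss sample $y_t=f(x_t)+\varepsilon_t$, where the $\varepsilon_t$ are i.i.d. and $1$-sub-Gaussian, hence of mean zero. The regret is $R(T)=\sum_{t=1}^T (f(x_t)-f(x^*))$. **Geometric Narrowing.** Let $\operatorname{diam}X\le\Delta$ with $\Delta>0$ (e.g. $\Delta=1$ after normalisation) and let $T\ge2$. Put $\hat\eta=\frac{q+d}{2q+d}$, $\hat c_1=\frac{\log (T/\log T)}{2(2q+d)\log 2}$, $\hat c_{i+1}=\hat\eta\,\hat c_i$, $M=\Big\lceil \frac{\log\log (T/\log T)}{\log(1/\hat\eta)}\Big\rceil$ and, for $k=1,\dots,M$,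 $\bar r_{2k-1}=\Delta 2^{-\lfloor \hat c_1+\dots+\hat c_k\rfloor}$, $\bar r_{2k}=\Delta 2^{-\lceil \hat c_1+\dots+\hat c_k\rceil}$; put $n_m=\big\lceil \frac{16\log T}{\lambda^2\bar r_m^{2q}}\big\rceil$. Start with the region $S=X$, radius $r=\Delta$ and time $t=0$. Go through $m=1,\dots,2M$, skipping those $m<2M$ with $\bar r_{m+1}>\bar r_m$. For each $m$ that is not skipped: 1. Cover $S$ by a collection $\mathcal A_m^{pre}$ of balls of radius $\bar r_m$, each meeting $S$, using at most $(r/\bar r_m)^d$ of them for each ball of a smallest cover of $S$ by balls of radius $r$. 2. If $t+|\mathcal A_m^{pre}|\,n_m\ge T$, leave the loop. 3. Otherwise play the centre of each ball of $\mathcal A_m^{pre}$ exactly $n_m$ times; the next communication point is $t+|\mathcal A_m^{pre}|\,n_m$, which becomes the new $t$. Let $B_m^{\min}$ be a ball with the smallest average observed loss. 4. Keep the balls $B\in\mathcal A_m^{pre}$ with $\sup_{x\in B,\,x'\in B_m^{\min}}\mathcal D(x,x')\le\big(3+(\frac{\lambda+L}{\lambda})^{1/q}\big)\bar r_m$. Let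 $S$ be the union of the kept balls and $r=\bar r_m$. After the loop, points of $S$ are played until all $T$ steps are used; $T$ is the last communication point. The cover, the order of its balls, the tie-breaking and the cleanup points are given by an arbitrary deterministic rule. **Theorem.** Let $L\ge\lambda>0$, $q\ge1$ and $\Delta>0$. There are constants $K_+,A_+,C>0$, depending only on $\lambda,L,q,\Delta$, such that the following holds for every compact doubling metric space $X$ of diameter at most $\Delta$ and doubling dimension $d$, every nondegenerate $f$ on $X$ with parameters $\lambda,L,q$, every choice rule and every integer $T\ge2$. 1. With probability exceeding $1-2/T$, the regret of Geometric Narrowing satisfies $$R^{GN}(T)\le K_+A_+^{d}\sqrt{T\log T}\;\log\log\frac{T}{\log T}.$$ 2. Geometric Narrowing obeys batched feedback with an adaptive grid $0=t_0<t_1<\dots<T$: the communication point $t_{j+1}$ and all arms played up to it depend only on the loss samples of the first $t_j$ steps. If $T\ge3$, the grid has at most $C\,(d+1)\log\log T$ points, whatever the losses are. -/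

import Mathlib

open MeasureTheory ProbabilityTheory
open scoped NNReal ENNReal

noncomputable section

/-! ### Doubling spaces and nondegenerate functions -/

/-- The doubling constant: the least `N` such that every closed ball of radius `r > 0` is covered
by `N` closed balls of radius `r / 2` (it is `⊤` if there is no such `N`). -/
def doublingConst (X : Type*) [MetricSpace X] : ℕ∞ :=
  ⨆ (x : X) (r : ℝ≥0) (_ : 0 < r), Metric.externalCoveringNumber (r / 2) (Metric.closedBall x r)

/-- A metric space is doubling if its doubling constant is finite. -/
def IsDoublingSpace (X : Type*) [MetricSpace X] : Prop := doublingConst X ≠ ⊤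

/-- The doubling dimension `d = log₂ N`. -/
def doublingDim (X : Type*) [MetricSpace X] : ℝ := Real.logb 2 ((doublingConst X).toNat : ℝ)

/-- `f` is nondegenerate with parameters `L ≥ lam > 0`, `q ≥ 1` and unique minimiser `xs`. -/
structure IsNondegenerate {X : Type*} [MetricSpace X] (f : X → ℝ) (xs : X) (lam L q : ℝ) :
    Prop where
  lam_pos : 0 < lam
  lam_le : lam ≤ L
  one_le : 1 ≤ q
  unique_min : ∀ x, x ≠ xs → f xs < f x
  lower : ∀ x, lam * dist x xs ^ q ≤ f x - f xs
  upper : ∀ x, f x - f xs ≤ L * dist x xs ^ q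

/-! ### The rounded radius sequence -/

/-- `η = (q + d) / (2 q + d)`. -/
def etaHat (q d : ℝ) : ℝ := (q + d) / (2 * q + d)

/-- `c₁ = log (T / log T) / (2 (2 q + d) log 2)`. -/
def cHatOne (q d : ℝ) (T : ℕ) : ℝ :=
  Real.log (T / Real.log T) / (2 * (2 * q + d) * Real.log 2)

/-- `c₁ + ⋯ + c_k`, where `c_{i+1} = η c_i`. -/
def cHatSum (q d : ℝ) (T k : ℕ) : ℝ := ∑ i ∈ Finset.range k, etaHat q d ^ i * cHatOne q d T

/-- The rounded radius with index `m = 1, …, 2 M`, in units of `Δ`: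
`Δ 2 ^ (-⌊c₁ + ⋯ + c_k⌋)` for `m = 2 k - 1` and `Δ 2 ^ (-⌈c₁ + ⋯ + c_k⌉)` for `m = 2 k`. -/
def roundedRadius (Δ q d : ℝ) (T m : ℕ) : ℝ :=
  if Even m then Δ * (1 / 2) ^ ⌈cHatSum q d T (m / 2)⌉₊
  else Δ * (1 / 2) ^ ⌊cHatSum q d T ((m + 1) / 2)⌋₊

/-- The number of arm pulls per ball in batch `m`: `16 log T / (lam² r_m^{2q})`, rounded up. -/
def pullsPerBall (lam Δ q d : ℝ) (T m : ℕ) : ℕ :=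
  ⌈16 * Real.log T / (lam ^ 2 * roundedRadius Δ q d T m ^ (2 * q))⌉₊

/-- The indices `m ∈ {1, …, 2 M}` that are not skipped, in increasing order; `m < 2 M` is skipped
if `r_{m+1} > r_m`. -/
def batchIndices (Δ q d : ℝ) (T M : ℕ) : List ℕ :=
  open scoped Classical in
  (List.range' 1 (2 * M)).filter fun m =>
    m = 2 * M ∨ roundedRadius Δ q d T (m + 1) ≤ roundedRadius Δ q d T m

/-- Half the number of batches: `log log (T / log T) / log (1 / η)`, rounded up. -/
def halfBatches (q d : ℝ) (T : ℕ) : ℕ :=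
  ⌈Real.log (Real.log (T / Real.log T)) / Real.log (1 / etaHat q d)⌉₊

/-! ### The Geometric Narrowing algorithm -/

/-- The largest distance `D(S, S') = sup {dist x x' | x ∈ S, x' ∈ S'}` between two sets. -/
def supDist {X : Type*} [MetricSpace X] (S S' : Set X) : ℝ := sSup (Set.image2 dist S S')

/-- The closed balls of radius `r'` with centres in the list `l` are an admissible refinement of the
region `S`, which was described by balls of radius `r`: they cover `S`, each of them meets `S`, and
there are at most `(r / r') ^ d` of them for each ball of a smallest cover of `S` by balls of
radius `r`. -/
structure IsRefinement {X : Type*} [MetricSpace X] (r r' : ℝ) (S : Set X) (l : List X) :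
    Prop where
  covers : S ⊆ ⋃ c ∈ l, Metric.closedBall c r'
  meets : ∀ c ∈ l, (Metric.closedBall c r' ∩ S).Nonempty
  card_le : (l.length : ℝ) ≤
    (r / r') ^ doublingDim X * ((Metric.externalCoveringNumber r.toNNReal S).toNat : ℝ)

/-- The choices that the algorithm leaves open: which admissible refinement to use and in which
order to play its balls, how to break ties between minimising balls, and which point of the
surviving region to play at each step of the cleanup. -/
structure GNChoices (X : Type*) [MetricSpace X] where
  /-- the refinement used in batch `m`, passing from radius `r` to radius `r'` in region `S` -/
  cover : (m : ℕ) → (r r' : ℝ) → (S : Set X) → List X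
  cover_spec : ∀ m r r' S, (∃ l, IsRefinement r r' S l) → IsRefinement r r' S (cover m r r' S)
  /-- the ball chosen in batch `m` among the (centres of the) balls of smallest average loss -/
  tie : (m : ℕ) → Set X → X
  tie_spec : ∀ m S, S.Nonempty → tie m S ∈ S
  /-- the point of the region `S` played at step `t` of the cleanup -/
  clean : (t : ℕ) → Set X → X
  clean_spec : ∀ t S, S.Nonempty → clean t S ∈ S

/-- The state of the algorithm between two batches. -/
structure GNState (X : Type*) where
  /-- the last communication point, i.e. the number of steps used so far -/
  time : ℕ
  /-- the radius of the current balls -/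
  rad : ℝ
  /-- the union of the balls that have not been eliminated -/
  region : Set X
  /-- the arms played so far -/
  arms : List X
  /-- the communication points so far, `t₀ = 0` included -/
  points : List ℕ

/-- The average observed loss of the `i`-th ball of a batch that starts after `t` steps and plays the
centres listed in `l` one after the other, each `n` times. Here `loss s x` is the loss sample
observed if the arm `x` is played at step `s` (steps are numbered from `0`). -/
def avgLoss {X : Type*} (loss : ℕ → X → ℝ) (t n : ℕ) (l : List X) (i : Fin l.length) : ℝ :=
  (∑ k ∈ Finset.range n, loss (t + i * n + k) (l.get i)) / n

/-- The batches with the listed indices, carried out one after the other from a given state. Before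
each batch its end point is computed; if it is `≥ T`, the loop is left. In a batch, every ball of the
refinement `pre` is sampled `n` times at its centre, and a ball is kept if its largest distance to
the ball of smallest average loss is at most `(3 + ((lam + L) / lam) ^ (1 / q)) r`. -/
def gnLoop {X : Type*} [MetricSpace X] (lam L q Δ : ℝ) (T : ℕ) (ch : GNChoices X)
    (loss : ℕ → X → ℝ) : List ℕ → GNState X → GNState X
  | [], s => s
  | m :: ms, s =>
    let d := doublingDim X
    let r := roundedRadius Δ q d T m
    let n := pullsPerBall lam Δ q d T m
    let pre := ch.cover m s.rad r s.region
    let t' := s.time + pre.length * n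
    if T ≤ t' then s
    else
      let fhat := avgLoss loss s.time n pre
      let xmin := ch.tie m {x | ∃ i, x = pre.get i ∧ ∀ j, fhat i ≤ fhat j}
      let kept : Set X := {x | x ∈ pre ∧
        supDist (Metric.closedBall x r) (Metric.closedBall xmin r) ≤
          (3 + ((lam + L) / lam) ^ (1 / q)) * r}
      gnLoop lam L q Δ T ch loss ms
        { time := t'
          rad := r
          region := ⋃ x ∈ kept, Metric.closedBall x r
          arms := s.arms ++ pre.flatMap fun x => List.replicate n x
          points := s.points ++ [t'] }

/-- The state when the cleanup starts, with `2 M` batch indices. At the start nothing is eliminated: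
the region is the whole space, which has diameter at most `Δ`. -/
def gnFinal {X : Type*} [MetricSpace X] (lam L q Δ : ℝ) (T M : ℕ) (ch : GNChoices X)
    (loss : ℕ → X → ℝ) : GNState X :=
  gnLoop lam L q Δ T ch loss (batchIndices Δ q (doublingDim X) T M)
    { time := 0, rad := Δ, region := Set.univ, arms := [], points := [0] }

/-- The arm played at step `t = 0, …, T - 1`; after the batches, the cleanup plays points of the
surviving region. -/
def gnArm {X : Type*} [MetricSpace X] (lam L q Δ : ℝ) (T M : ℕ) (ch : GNChoices X)
    (loss : ℕ → X → ℝ) (t : ℕ) : X :=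
  let s := gnFinal lam L q Δ T M ch loss
  s.arms.getD t (ch.clean t s.region)

/-- The communication points `0 = t₀ < t₁ < ⋯ < T`. -/
def gnGrid {X : Type*} [MetricSpace X] (lam L q Δ : ℝ) (T M : ℕ) (ch : GNChoices X)
    (loss : ℕ → X → ℝ) : List ℕ :=
  (gnFinal lam L q Δ T M ch loss).points ++ [T]

/-! ### Batched feedback, noise and regret -/

/-- A procedure that, run on the loss samples `loss`, plays the arms `arm loss t` (`t < T`) and has
the communication points `grid loss`, obeys batched feedback with an adaptive grid: the grid is
`0 = t₀ < t₁ < ⋯ < T`, and the communication point `t_{j+1}` and all arms played before it depend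
only on the loss samples of the arms played before `t_j`. -/
structure IsBatchedRun {X : Type*} (T : ℕ) (arm : (ℕ → X → ℝ) → ℕ → X)
    (grid : (ℕ → X → ℝ) → List ℕ) : Prop where
  head : ∀ loss, (grid loss).head? = some 0
  last : ∀ loss, (grid loss).getLast? = some T
  increasing : ∀ loss, (grid loss).Pairwise (· < ·)
  nonanticipating : ∀ loss loss' j a b, (grid loss)[j]? = some a → (grid loss)[j + 1]? = some b →
    (∀ t < a, loss' t (arm loss t) = loss t (arm loss t)) →
    (grid loss')[j + 1]? = some b ∧ ∀ t < b, arm loss' t = arm loss t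

/-- Independent, identically distributed noise variables that are `1`-sub-Gaussian (hence of mean
zero). -/
structure IsSubgaussianNoise {Ω : Type*} [MeasurableSpace Ω] (μ : Measure Ω) (ε : ℕ → Ω → ℝ) :
    Prop where
  measurable : ∀ t, Measurable (ε t)
  indep : iIndepFun ε μ
  identDistrib : ∀ t, IdentDistrib (ε t) (ε 0) μ μ
  subgaussian : ∀ t, HasSubgaussianMGF (ε t) 1 μ

/-- The `T`-step regret of a sequence of arms. -/
def regret {X : Type*} (f : X → ℝ) (xs : X) (T : ℕ) (arm : ℕ → X) : ℝ :=
  ∑ t ∈ Finset.range T, (f (arm t) - f xs)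

end

/-!
Geometric Narrowing works because each batch localises the minimiser `xs` on the scale of its own
radius. Suppose that the average losses of any two balls of a batch of radius `r` carry noises that
differ by at most `lam * r ^ q`. Then the ball that contains `xs` is never discarded: its average
loss bounds the value at the centre of the best-looking ball, and nondegeneracy turns this value
into a distance of at most `((lam + L) / lam) ^ (1 / q) * r` from `xs`, which is what the
elimination threshold allows for (`IsReachable.isLocalized_next`). So the surviving region lies in a
ball of radius `O(r)` around `xs`, every arm of the following batch `m` loses `O(r ^ q)`, and by
doubling that batch has `O(1) ^ d * (r / r_m) ^ d` balls. With `O(log T / r_m ^ (2 q))` plays per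
ball its regret is `O(1) ^ d * log T * r ^ (q + d) / r_m ^ (2 q + d)`
(`IsReachable.batch_cost_le`).

The radii are chosen so that this quotient is the same for all batches: with
`C_k = c₁ + ⋯ + c_k` one has `(2 q + d) C_{k+1} - (q + d) C_k = (2 q + d) c₁`, and
`2 ^ ((2 q + d) c₁) = √(T / log T)`. Rounding the exponents down and up costs a factor
`2 ^ (2 q + d)` at most; the skipped indices are exactly those where the rounding would increase the
radius, and `MayFollow` records what holds between consecutive batches that are carried out. Each of
the at most `2 M` batches therefore costs `O(1) ^ d * √(T log T)`, and so does the cleanup. If the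
loop is left early, the remaining steps are at most those of the batch that did not fit; otherwise
`M` is so large that the final radius `r` satisfies `T * r ^ q = O(√(T log T))`
(`mul_roundedRadius_last_le`). Finally `M = O((d + 1) log log T)`.

For the noise, the difference of the noise sums of two disjoint windows of `n` steps is
`2 n`-sub-Gaussian, hence below `4 √(n log T)` with probability at least `1 - T ^ (-4)`. A union
bound over all lengths and all pairs of deterministic positions, fewer than `T ^ 3` cases, covers
every position at which the adaptive algorithm can place a ball (`lt_measureReal_noiseGood`).

Batched feedback holds because a state determines the next communication point and the arms played
up to it, while the losses of these arms determine the next state (`gnLoop_nonanticipating`).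
-/

/-! ### Covering numbers in doubling spaces -/

section Covering

variable {X : Type*} [MetricSpace X]

lemma exists_finset_isCover {ε : ℝ≥0} {S : Set X} {n : ℕ}
    (h : Metric.externalCoveringNumber ε S ≤ n) :
    ∃ F : Finset X, F.card ≤ n ∧ Metric.IsCover ε S (F : Set X) := by
  have h' : Metric.externalCoveringNumber ε S < ((n + 1 : ℕ) : ℕ∞) :=
    h.trans_lt (by exact_mod_cast Nat.lt_succ_self n)
  simp only [Metric.externalCoveringNumber, iInf_lt_iff] at h'
  obtain ⟨C, hC, hlt⟩ := h'
  have hfin : C.Finite := Set.finite_of_encard_le_coe hlt.le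
  refine ⟨hfin.toFinset, ?_, by simpa using hC⟩
  rw [hfin.encard_eq_coe_toFinset_card] at hlt
  exact Nat.lt_succ_iff.1 (by exact_mod_cast hlt)

lemma externalCoveringNumber_closedBall_half_le (hX : IsDoublingSpace X) (x : X) {r : ℝ≥0}
    (hr : 0 < r) :
    Metric.externalCoveringNumber (r / 2) (Metric.closedBall x r) ≤
      ((doublingConst X).toNat : ℕ∞) := by
  rw [ENat.natCast_toNat hX]
  exact le_iSup_of_le x (le_iSup_of_le r (le_iSup_of_le hr le_rfl))

lemma one_le_toNat_doublingConst [Nonempty X] (hX : IsDoublingSpace X) :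
    1 ≤ (doublingConst X).toNat := by
  obtain ⟨x⟩ := ‹Nonempty X›
  have h := externalCoveringNumber_closedBall_half_le hX x (zero_lt_one' ℝ≥0)
  have h2 : 0 < Metric.externalCoveringNumber ((1 : ℝ≥0) / 2) (Metric.closedBall x (1 : ℝ≥0)) :=
    Metric.externalCoveringNumber_pos_iff.2 ⟨x, by simp⟩
  exact_mod_cast Order.one_le_iff_pos.2 (h2.trans_le h)

lemma doublingDim_nonneg [Nonempty X] (hX : IsDoublingSpace X) : 0 ≤ doublingDim X :=
  Real.logb_nonneg one_lt_two (by exact_mod_cast one_le_toNat_doublingConst hX)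

lemma two_rpow_doublingDim [Nonempty X] (hX : IsDoublingSpace X) :
    (2 : ℝ) ^ doublingDim X = (doublingConst X).toNat :=
  Real.rpow_logb two_pos (by norm_num)
    (by exact_mod_cast one_le_toNat_doublingConst hX)

lemma two_pow_rpow_doublingDim [Nonempty X] (hX : IsDoublingSpace X) (k : ℕ) :
    ((2 : ℝ) ^ k) ^ doublingDim X = ((doublingConst X).toNat : ℝ) ^ k := by
  rw [← two_rpow_doublingDim hX, ← Real.rpow_natCast, ← Real.rpow_natCast, ← Real.rpow_mul two_pos.le,
    ← Real.rpow_mul two_pos.le, mul_comm]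

lemma externalCoveringNumber_half_le (hX : IsDoublingSpace X) {ε : ℝ≥0} (hε : 0 < ε) {S : Set X}
    {n : ℕ} (h : Metric.externalCoveringNumber ε S ≤ n) :
    Metric.externalCoveringNumber (ε / 2) S ≤ ((n * (doublingConst X).toNat : ℕ) : ℕ∞) := by
  classical
  obtain ⟨F, hF, hc⟩ := exists_finset_isCover h
  choose G hG hGc using fun x : X =>
    exists_finset_isCover (externalCoveringNumber_closedBall_half_le hX x hε)
  have hcov : Metric.IsCover (ε / 2) S ((F.biUnion G : Finset X) : Set X) := by
    intro y hy
    obtain ⟨c, hcF, hyc⟩ := hc hy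
    have hyc' : y ∈ Metric.closedBall c (ε : ℝ) := by
      rw [← Metric.closedEBall_coe]
      exact hyc
    obtain ⟨z, hz, hyz⟩ := hGc c hyc'
    exact ⟨z, by simpa using ⟨c, hcF, hz⟩, hyz⟩
  refine hcov.externalCoveringNumber_le_encard.trans ?_
  rw [Set.encard_coe_eq_coe_finsetCard]
  have := Finset.card_biUnion_le_card_mul F G _ fun x _ => hG x
  exact_mod_cast this.trans (Nat.mul_le_mul_right _ hF)

/-- Iterating the doubling property `k` times divides the radius by `2 ^ k`. -/
lemma externalCoveringNumber_div_two_pow_le (hX : IsDoublingSpace X) {ε : ℝ≥0} (hε : 0 < ε)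
    {S : Set X} {n : ℕ} (h : Metric.externalCoveringNumber ε S ≤ n) (k : ℕ) :
    Metric.externalCoveringNumber (ε / 2 ^ k) S ≤
      ((n * (doublingConst X).toNat ^ k : ℕ) : ℕ∞) := by
  induction k with
  | zero => simpa using h
  | succ k ih =>
    have := externalCoveringNumber_half_le hX (ε := ε / 2 ^ k) (by positivity) ih
    rwa [div_div, ← pow_succ, mul_assoc, ← pow_succ] at this

lemma externalCoveringNumber_closedBall_le_one {x : X} {r : ℝ≥0} :
    Metric.externalCoveringNumber r (Metric.closedBall x r) ≤ ((1 : ℕ) : ℕ∞) := by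
  have : Metric.IsCover r (Metric.closedBall x r) ({x} : Set X) := by
    rw [Metric.isCover_iff_subset_iUnion_closedBall]
    simp
  simpa using this.externalCoveringNumber_le_encard

/-- A set inside a ball of radius `2 ^ k * r` is covered by `(2 ^ k) ^ d` balls of radius `r`. -/
lemma toNat_externalCoveringNumber_le [Nonempty X] (hX : IsDoublingSpace X) {x : X} {r : ℝ}
    (hr : 0 < r) {S : Set X} {k : ℕ} (hS : S ⊆ Metric.closedBall x (2 ^ k * r)) :
    ((Metric.externalCoveringNumber r.toNNReal S).toNat : ℝ) ≤
      ((2 : ℝ) ^ k) ^ doublingDim X := by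
  have h1 : (0 : ℝ≥0) < 2 ^ k * r.toNNReal := by
    have := Real.toNNReal_pos.2 hr
    positivity
  have h2 := externalCoveringNumber_div_two_pow_le hX h1
    (externalCoveringNumber_closedBall_le_one (x := x)) k
  rw [mul_div_cancel_left₀ _ (by positivity)] at h2
  have h3 : S ⊆ Metric.closedBall x ((2 ^ k * r.toNNReal : ℝ≥0) : ℝ) := by
    simpa [Real.coe_toNNReal _ hr.le] using hS
  have h4 := ENat.toNat_le_toNat ((Metric.externalCoveringNumber_mono_set h3).trans h2)
    (ENat.natCast_ne_top _)
  rw [ENat.toNat_natCast, one_mul] at h4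
  rw [two_pow_rpow_doublingDim hX]
  exact_mod_cast h4

/-- The doubling property provides admissible refinements between dyadically related radii. -/
lemma exists_isRefinement [Nonempty X] [CompactSpace X] (hX : IsDoublingSpace X) {Δ : ℝ}
    (hΔ : 0 < Δ) {e e' : ℕ} (he : e ≤ e') (S : Set X) :
    ∃ l, IsRefinement (Δ * (1 / 2) ^ e) (Δ * (1 / 2) ^ e') S l := by
  classical
  obtain ⟨k, rfl⟩ := Nat.exists_eq_add_of_le he
  set r : ℝ≥0 := (Δ * (1 / 2) ^ e).toNNReal with hr
  have hr0 : 0 < r := Real.toNNReal_pos.2 (by positivity)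
  have hrr : (r : ℝ) = Δ * (1 / 2) ^ e := Real.coe_toNNReal _ (by positivity)
  have hfin : Metric.externalCoveringNumber r S ≠ ⊤ := by
    obtain ⟨t, -, htf, ht⟩ := Metric.exists_finite_isCover_of_isCompact hr0.ne'
      (isCompact_univ (X := X))
    have h := (Metric.externalCoveringNumber_mono_set (Set.subset_univ S)).trans
      ht.externalCoveringNumber_le_encard
    exact ne_top_of_le_ne_top (Set.encard_ne_top_iff.2 htf) h
  obtain ⟨F, hF, hc⟩ := exists_finset_isCover
    (externalCoveringNumber_div_two_pow_le hX hr0 (ENat.natCast_toNat hfin).ge k)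
  have hrk : ((r / 2 ^ k : ℝ≥0) : ℝ) = Δ * (1 / 2) ^ (e + k) := by
    push_cast
    rw [hrr, pow_add, div_eq_mul_inv, mul_assoc, one_div, inv_pow 2 k]
  rw [Metric.isCover_iff_subset_iUnion_closedBall, hrk] at hc
  refine ⟨(F.filter fun c => (Metric.closedBall c (Δ * (1 / 2) ^ (e + k)) ∩ S).Nonempty).toList,
    ?_, ?_, ?_⟩
  · intro y hy
    obtain ⟨c, hcF, hyc⟩ := Set.mem_iUnion₂.1 (hc hy)
    refine Set.mem_iUnion₂.2 ⟨c, ?_, hyc⟩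
    simp only [Finset.mem_toList, Finset.mem_filter]
    exact ⟨hcF, y, hyc, hy⟩
  · intro c hcl
    simp only [Finset.mem_toList, Finset.mem_filter] at hcl
    exact hcl.2
  · have hdiv : Δ * (1 / 2) ^ e / (Δ * (1 / 2) ^ (e + k)) = (2 : ℝ) ^ k := by
      rw [pow_add, one_div_pow _ k]
      field_simp
    rw [hdiv, two_pow_rpow_doublingDim hX, Finset.length_toList]
    rw [mul_comm] at hF
    exact_mod_cast (Finset.card_filter_le _ _).trans hF

end Covering

/-! ### The radius sequence -/

section Radii

lemma exp_one_mul_log_lt {x : ℝ} (hx : 0 < x) (hxe : x ≠ Real.exp 1) :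
    Real.exp 1 * Real.log x < x := by
  have h1 : x / Real.exp 1 ≠ 1 := by
    rw [Ne, div_eq_one_iff_eq (Real.exp_ne_zero 1)]
    exact hxe
  have h := Real.log_lt_sub_one_of_pos (by positivity : 0 < x / Real.exp 1) h1
  rw [Real.log_div hx.ne' (Real.exp_ne_zero 1), Real.log_exp, sub_lt_sub_iff_right,
    lt_div_iff₀ (Real.exp_pos 1)] at h
  linarith

lemma log_log_div_log_pos {x : ℝ} (hx : 1 < x) (hxe : x ≠ Real.exp 1) :
    0 < Real.log (Real.log (x / Real.log x)) := by
  have hl : 0 < Real.log x := Real.log_pos hx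
  have h := exp_one_mul_log_lt (by linarith) hxe
  apply Real.log_pos
  rw [Real.lt_log_iff_exp_lt (by positivity), lt_div_iff₀ hl]
  exact h

/-- Among the integers, `T / log T` is smallest at `T = 3`, where it still exceeds `e`; hence
`log log (T / log T)` is bounded below by a positive number. -/
lemma exists_le_log_log_div_log :
    ∃ c : ℝ, 0 < c ∧ ∀ T : ℕ, 2 ≤ T → c ≤ Real.log (Real.log (T / Real.log T)) := by
  have he1 : Real.exp 1 < 2.7182818286 := Real.exp_one_lt_d9
  have he2 : 2.7182818283 < Real.exp 1 := Real.exp_one_gt_d9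
  have p2 := log_log_div_log_pos (x := 2) (by norm_num) (by linarith)
  have p3 := log_log_div_log_pos (x := 3) (by norm_num) (by linarith)
  refine ⟨min (Real.log (Real.log (2 / Real.log 2))) (Real.log (Real.log (3 / Real.log 3))),
    lt_min p2 p3, fun T hT => ?_⟩
  rcases eq_or_lt_of_le hT with rfl | hT3
  · exact_mod_cast min_le_left _ _
  · refine (min_le_right _ _).trans ?_
    have hT3' : (3 : ℝ) ≤ T := by exact_mod_cast hT3
    have l3 : 0 < Real.log 3 := Real.log_pos (by norm_num)
    have lT : 0 < Real.log T := Real.log_pos (by linarith)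
    have hanti := Real.log_div_self_antitoneOn (a := 3) (b := T)
      (show Real.exp 1 ≤ 3 by linarith) (show Real.exp 1 ≤ T by linarith) hT3'
    have hle : 3 / Real.log 3 ≤ T / Real.log T := by
      have := one_div_le_one_div_of_le (by positivity) hanti
      simpa using this
    have h1 : 0 < Real.log (3 / Real.log 3) := by
      have := exp_one_mul_log_lt (x := 3) (by norm_num) (by linarith)
      apply Real.log_pos
      rw [lt_div_iff₀ l3]
      nlinarith
    exact Real.log_le_log h1 (Real.log_le_log (by positivity) hle)

lemma log_log_div_log_nat_pos {T : ℕ} (hT : 2 ≤ T) :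
    0 < Real.log (Real.log (T / Real.log T)) := by
  obtain ⟨c, hc, h⟩ := exists_le_log_log_div_log
  exact hc.trans_le (h T hT)

lemma log_nat_pos {T : ℕ} (hT : 2 ≤ T) : 0 < Real.log (T : ℝ) :=
  Real.log_pos (by exact_mod_cast hT)

lemma one_lt_log_div_log {T : ℕ} (hT : 2 ≤ T) : 1 < Real.log (T / Real.log T) := by
  have h2 : (2 : ℝ) ≤ T := by exact_mod_cast hT
  have hl := log_nat_pos hT
  have h0 : 0 ≤ Real.log (T / Real.log T) := by
    apply Real.log_nonneg
    rw [one_le_div hl]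
    linarith [Real.log_le_sub_one_of_pos (show (0 : ℝ) < T by linarith)]
  by_contra hcon
  exact absurd (log_log_div_log_nat_pos hT) (not_lt.2 (Real.log_nonpos h0 (not_lt.1 hcon)))

/-- The exponent `e` in `roundedRadius = Δ * (1 / 2) ^ e`. -/
noncomputable def radiusExp (q d : ℝ) (T m : ℕ) : ℕ :=
  if Even m then ⌈cHatSum q d T (m / 2)⌉₊ else ⌊cHatSum q d T ((m + 1) / 2)⌋₊

lemma roundedRadius_eq (Δ q d : ℝ) (T m : ℕ) :
    roundedRadius Δ q d T m = Δ * (1 / 2) ^ radiusExp q d T m := by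
  unfold roundedRadius radiusExp
  split_ifs <;> rfl

lemma roundedRadius_pos {Δ : ℝ} (hΔ : 0 < Δ) (q d : ℝ) (T m : ℕ) :
    0 < roundedRadius Δ q d T m := by
  rw [roundedRadius_eq]
  positivity

lemma roundedRadius_zero (Δ q d : ℝ) (T : ℕ) : roundedRadius Δ q d T 0 = Δ := by
  simp [roundedRadius, cHatSum]

lemma roundedRadius_le_iff {Δ : ℝ} (hΔ : 0 < Δ) (q d : ℝ) (T m m' : ℕ) :
    roundedRadius Δ q d T m' ≤ roundedRadius Δ q d T m ↔
      radiusExp q d T m ≤ radiusExp q d T m' := by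
  rw [roundedRadius_eq, roundedRadius_eq, mul_le_mul_iff_right₀ hΔ]
  exact pow_le_pow_iff_right_of_lt_one₀ (by norm_num) (by norm_num)

lemma roundedRadius_eq_rpow (Δ q d : ℝ) (T m : ℕ) :
    roundedRadius Δ q d T m = Δ * (2 : ℝ) ^ (-(radiusExp q d T m : ℝ)) := by
  rw [roundedRadius_eq, Real.rpow_neg two_pos.le, Real.rpow_natCast, one_div, inv_pow]

lemma radiusExp_two_mul (q d : ℝ) (T k : ℕ) : radiusExp q d T (2 * k) = ⌈cHatSum q d T k⌉₊ := by
  simp [radiusExp]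

lemma radiusExp_two_mul_add_one (q d : ℝ) (T k : ℕ) :
    radiusExp q d T (2 * k + 1) = ⌊cHatSum q d T (k + 1)⌋₊ := by
  have h : (2 * k + 1 + 1) / 2 = k + 1 := by omega
  simp [radiusExp, h]

variable {q d : ℝ} {T : ℕ}

lemma etaHat_pos (hq : 1 ≤ q) (hd : 0 ≤ d) : 0 < etaHat q d := by
  unfold etaHat
  have : 0 < q := by linarith
  positivity

lemma one_sub_etaHat (hq : 1 ≤ q) (hd : 0 ≤ d) : 1 - etaHat q d = q / (2 * q + d) := by
  unfold etaHat
  have : 2 * q + d ≠ 0 := by linarith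
  field_simp
  ring

lemma etaHat_lt_one (hq : 1 ≤ q) (hd : 0 ≤ d) : etaHat q d < 1 := by
  have h := one_sub_etaHat hq hd
  have : 0 < q / (2 * q + d) := div_pos (by linarith) (by linarith)
  linarith

lemma cHatOne_pos (hq : 1 ≤ q) (hd : 0 ≤ d) (hT : 2 ≤ T) : 0 < cHatOne q d T := by
  have h := one_lt_log_div_log hT
  have h2 := Real.log_pos (one_lt_two (α := ℝ))
  exact div_pos (by linarith) (mul_pos (by linarith) h2)

lemma cHatSum_mono (hq : 1 ≤ q) (hd : 0 ≤ d) (hT : 2 ≤ T) : Monotone (cHatSum q d T) := by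
  refine monotone_nat_of_le_succ fun k => ?_
  have h1 := cHatOne_pos hq hd hT
  have h2 := etaHat_pos hq hd
  rw [cHatSum, cHatSum, Finset.sum_range_succ]
  have : 0 ≤ etaHat q d ^ k * cHatOne q d T := by positivity
  linarith

lemma cHatSum_zero (q d : ℝ) (T : ℕ) : cHatSum q d T 0 = 0 := by simp [cHatSum]

lemma cHatSum_nonneg (hq : 1 ≤ q) (hd : 0 ≤ d) (hT : 2 ≤ T) (k : ℕ) : 0 ≤ cHatSum q d T k := by
  rw [← cHatSum_zero q d T]
  exact cHatSum_mono hq hd hT k.zero_le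

lemma cHatSum_succ (q d : ℝ) (T k : ℕ) :
    cHatSum q d T (k + 1) = cHatOne q d T + etaHat q d * cHatSum q d T k := by
  rw [cHatSum, cHatSum, Finset.sum_range_succ', Finset.mul_sum, pow_zero, one_mul, add_comm]
  congr 1
  exact Finset.sum_congr rfl fun i _ => by ring

/-- The identity that makes the regret of all batches the same. -/
lemma mul_cHatSum_succ_sub (hq : 1 ≤ q) (hd : 0 ≤ d) (T k : ℕ) :
    (2 * q + d) * cHatSum q d T (k + 1) - (q + d) * cHatSum q d T k =
      (2 * q + d) * cHatOne q d T := by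
  rw [cHatSum_succ, etaHat]
  have : 2 * q + d ≠ 0 := by linarith
  field_simp
  ring

lemma mul_cHatSum (hq : 1 ≤ q) (hd : 0 ≤ d) (T k : ℕ) :
    q * cHatSum q d T k = (2 * q + d) * cHatOne q d T * (1 - etaHat q d ^ k) := by
  have h := mul_neg_geom_sum (etaHat q d) k
  rw [one_sub_etaHat hq hd] at h
  have h0 : 2 * q + d ≠ 0 := by linarith
  rw [cHatSum, ← Finset.sum_mul, ← h]
  field_simp

lemma q_mul_cHatSum_le (hq : 1 ≤ q) (hd : 0 ≤ d) (hT : 2 ≤ T) (k : ℕ) :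
    q * cHatSum q d T k ≤ (2 * q + d) * cHatOne q d T := by
  have h1 := mul_cHatSum_succ_sub hq hd T k
  have h2 := cHatSum_mono hq hd hT (Nat.le_succ k)
  have : (2 * q + d) * cHatSum q d T k ≤ (2 * q + d) * cHatSum q d T (k + 1) :=
    mul_le_mul_of_nonneg_left h2 (by linarith)
  linarith

/-- Batch `m` may follow batch `p`: the radius does not increase, and up to a factor `2 ^ (2 q + d)`
the quotient `r_p ^ (q + d) / r_m ^ (2 q + d)` is that of the unrounded radii. -/
def MayFollow (q d : ℝ) (T p m : ℕ) : Prop :=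
  radiusExp q d T p ≤ radiusExp q d T m ∧
    (2 * q + d) * radiusExp q d T m - (q + d) * radiusExp q d T p ≤
      (2 * q + d) * cHatOne q d T + (2 * q + d)

lemma mayFollow_ceil_floor (hq : 1 ≤ q) (hd : 0 ≤ d) (hT : 2 ≤ T) {k : ℕ}
    (h : radiusExp q d T (2 * k) ≤ radiusExp q d T (2 * k + 1)) :
    MayFollow q d T (2 * k) (2 * k + 1) := by
  refine ⟨h, ?_⟩
  rw [radiusExp_two_mul, radiusExp_two_mul_add_one]
  have h1 := Nat.floor_le (cHatSum_nonneg hq hd hT (k + 1))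
  have h2 := Nat.le_ceil (cHatSum q d T k)
  have h3 := mul_cHatSum_succ_sub hq hd T k
  have h4 := mul_le_mul_of_nonneg_left h1 (show 0 ≤ 2 * q + d by linarith)
  have h5 := mul_le_mul_of_nonneg_left h2 (show 0 ≤ q + d by linarith)
  linarith

lemma radiusExp_floor_le_ceil (q d : ℝ) (T k : ℕ) :
    radiusExp q d T (2 * k + 1) ≤ radiusExp q d T (2 * k + 2) := by
  rw [radiusExp_two_mul_add_one, show 2 * k + 2 = 2 * (k + 1) by ring, radiusExp_two_mul]
  exact Nat.floor_le_ceil _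

lemma mayFollow_floor_ceil (hq : 1 ≤ q) (hd : 0 ≤ d) (hT : 2 ≤ T) (k : ℕ) :
    MayFollow q d T (2 * k + 1) (2 * k + 2) := by
  refine ⟨radiusExp_floor_le_ceil q d T k, ?_⟩
  rw [radiusExp_two_mul_add_one, show 2 * k + 2 = 2 * (k + 1) by ring, radiusExp_two_mul]
  have h1 := Nat.floor_le (cHatSum_nonneg hq hd hT (k + 1))
  have h2 : (⌈cHatSum q d T (k + 1)⌉₊ : ℝ) ≤ ⌊cHatSum q d T (k + 1)⌋₊ + 1 := by
    exact_mod_cast Nat.ceil_le_floor_add_one _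
  have h3 := q_mul_cHatSum_le hq hd hT (k + 1)
  have h4 := mul_le_mul_of_nonneg_left h2 (show 0 ≤ 2 * q + d by linarith)
  have h5 := mul_le_mul_of_nonneg_left h1 (show 0 ≤ q by linarith)
  linarith

/-- If `m = 2 k + 2` is skipped, then `2 k + 1` and `2 k + 3` have the same radius. -/
lemma mayFollow_floor_floor (hq : 1 ≤ q) (hd : 0 ≤ d) (hT : 2 ≤ T) {k : ℕ}
    (h : radiusExp q d T (2 * k + 3) < radiusExp q d T (2 * k + 2)) :
    MayFollow q d T (2 * k + 1) (2 * k + 3) := by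
  have heq : radiusExp q d T (2 * k + 3) = radiusExp q d T (2 * k + 1) := by
    rw [show 2 * k + 3 = 2 * (k + 1) + 1 by ring, show 2 * k + 2 = 2 * (k + 1) by ring,
      radiusExp_two_mul_add_one, radiusExp_two_mul] at h
    rw [show 2 * k + 3 = 2 * (k + 1) + 1 by ring, radiusExp_two_mul_add_one,
      radiusExp_two_mul_add_one]
    apply le_antisymm
    · have := Nat.ceil_le_floor_add_one (cHatSum q d T (k + 1))
      omega
    · exact Nat.floor_mono (cHatSum_mono hq hd hT (Nat.le_succ _))
  refine ⟨heq.ge, ?_⟩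
  rw [heq, radiusExp_two_mul_add_one]
  have h1 := Nat.floor_le (cHatSum_nonneg hq hd hT (k + 1))
  have h3 := q_mul_cHatSum_le hq hd hT (k + 1)
  have h5 := mul_le_mul_of_nonneg_left h1 (show 0 ≤ q by linarith)
  linarith

open scoped Classical in
/-- Only even indices are skipped, so the batch before `a` has index `a - 1`, or `a - 2` if `a - 1`
is skipped. -/
lemma isChain_mayFollow_range' (hq : 1 ≤ q) (hd : 0 ≤ d) (hT : 2 ≤ T) (M n a p : ℕ)
    (ha : a + n = 2 * M + 1)
    (h : (p + 1 = a ∧ (0 < n → radiusExp q d T p ≤ radiusExp q d T a)) ∨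
      (0 < n ∧ p + 2 = a ∧ Odd p ∧ radiusExp q d T a < radiusExp q d T (p + 1))) :
    ((p :: (List.range' a n).filter fun m =>
      m = 2 * M ∨ radiusExp q d T m ≤ radiusExp q d T (m + 1)).IsChain (MayFollow q d T)) ∧
    (p :: (List.range' a n).filter fun m =>
      m = 2 * M ∨ radiusExp q d T m ≤ radiusExp q d T (m + 1)).getLast? = some (2 * M) := by
  induction n generalizing a p with
  | zero =>
    have hp : p = 2 * M := by omega
    simp [hp]
  | succ n ih =>
    have hrel : MayFollow q d T p a := by
      rcases h with ⟨rfl, h⟩ | ⟨-, rfl, ⟨k, rfl⟩, h⟩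
      · rcases Nat.even_or_odd' p with ⟨k, rfl | rfl⟩
        · exact mayFollow_ceil_floor hq hd hT (h n.succ_pos)
        · exact mayFollow_floor_ceil hq hd hT k
      · exact mayFollow_floor_floor hq hd hT h
    rw [List.range'_succ]
    by_cases hP : a = 2 * M ∨ radiusExp q d T a ≤ radiusExp q d T (a + 1)
    · have := ih (a + 1) a (by omega) (Or.inl ⟨rfl, fun hn => hP.resolve_left (by omega)⟩)
      rw [List.filter_cons_of_pos (by simpa using hP)]
      refine ⟨List.isChain_cons_cons.2 ⟨hrel, this.1⟩, ?_⟩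
      rw [List.getLast?_cons_cons]
      exact this.2
    · rw [List.filter_cons_of_neg (by simpa using hP)]
      push Not at hP
      rcases h with ⟨rfl, h⟩ | ⟨-, rfl, ⟨k, rfl⟩, h⟩
      · refine ih _ p (by omega) (Or.inr ⟨by omega, rfl, ?_, hP.2⟩)
        rcases Nat.even_or_odd' p with ⟨k, rfl | rfl⟩
        · exact absurd hP.2 (not_lt.2 (radiusExp_floor_le_ceil q d T k))
        · exact ⟨k, rfl⟩
      · exact absurd hP.2 (not_lt.2 (radiusExp_floor_le_ceil q d T (k + 1)))

lemma batchIndices_eq {Δ : ℝ} (hΔ : 0 < Δ) (q d : ℝ) (T M : ℕ) :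
    batchIndices Δ q d T M = open scoped Classical in
      (List.range' 1 (2 * M)).filter fun m =>
        m = 2 * M ∨ radiusExp q d T m ≤ radiusExp q d T (m + 1) := by
  simp only [batchIndices, roundedRadius_le_iff hΔ]

lemma batchIndices_spec {Δ : ℝ} (hΔ : 0 < Δ) (hq : 1 ≤ q) (hd : 0 ≤ d) (hT : 2 ≤ T) (M : ℕ) :
    (0 :: batchIndices Δ q d T M).IsChain (MayFollow q d T) ∧
      (0 :: batchIndices Δ q d T M).getLast? = some (2 * M) := by
  rw [batchIndices_eq hΔ]
  refine isChain_mayFollow_range' hq hd hT M (2 * M) 1 0 (by omega) (Or.inl ⟨rfl, fun _ => ?_⟩)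
  have : radiusExp q d T 0 = 0 := by simp [radiusExp, cHatSum]
  omega

lemma length_batchIndices_le (Δ q d : ℝ) (T M : ℕ) : (batchIndices Δ q d T M).length ≤ 2 * M := by
  classical
  exact (List.length_filter_le _ _).trans (by simp)

lemma halfBatches_le (hq : 1 ≤ q) (hd : 0 ≤ d) (hT : 2 ≤ T) :
    (halfBatches q d T : ℝ) ≤ (d + 2) * Real.log (Real.log (T / Real.log T)) + 1 := by
  have hLL := log_log_div_log_nat_pos hT
  have h1 := etaHat_pos hq hd
  have hlog : 1 / (d + 2) ≤ Real.log (1 / etaHat q d) := by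
    have h2 := Real.log_le_sub_one_of_pos h1
    have h3 := one_sub_etaHat hq hd
    have h4 : 1 / (d + 2) ≤ q / (2 * q + d) := by
      rw [div_le_div_iff₀ (by linarith) (by linarith)]
      nlinarith
    rw [one_div (etaHat q d), Real.log_inv]
    linarith
  have hd2 : 0 < 1 / (d + 2) := by
    have : 0 < d + 2 := by linarith
    positivity
  have h5 : 0 < Real.log (1 / etaHat q d) := hd2.trans_le hlog
  unfold halfBatches
  refine (Nat.ceil_lt_add_one (by positivity)).le.trans ?_
  gcongr
  calc _ ≤ Real.log (Real.log (T / Real.log T)) / (1 / (d + 2)) := by gcongr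
    _ = _ := by rw [div_div_eq_mul_div, div_one, mul_comm]

/-- `M` is large enough for `(T / log T) ^ (η ^ M)` to be bounded by `e`. -/
lemma etaHat_pow_halfBatches_le (hq : 1 ≤ q) (hd : 0 ≤ d) (hT : 2 ≤ T) :
    etaHat q d ^ halfBatches q d T * Real.log (T / Real.log T) ≤ 1 := by
  have h1 := etaHat_pos hq hd
  have hl := one_lt_log_div_log hT
  have h5 : 0 < Real.log (1 / etaHat q d) :=
    Real.log_pos (one_lt_one_div h1 (etaHat_lt_one hq hd))
  have h6 : Real.log (Real.log (T / Real.log T)) / Real.log (1 / etaHat q d) ≤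
    halfBatches q d T := Nat.le_ceil _
  rw [div_le_iff₀ h5, one_div, Real.log_inv] at h6
  have h7 : 0 < etaHat q d ^ halfBatches q d T * Real.log (T / Real.log T) := by positivity
  rw [← Real.log_nonpos_iff h7.le, Real.log_mul (by positivity) (by positivity), Real.log_pow]
  linarith

lemma two_rpow_mul_cHatOne (hq : 1 ≤ q) (hd : 0 ≤ d) (hT : 2 ≤ T) :
    (2 : ℝ) ^ ((2 * q + d) * cHatOne q d T) = Real.sqrt (T / Real.log T) := by
  have hl := log_nat_pos hT
  have hT0 : (0 : ℝ) < T := by positivity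
  have h2 := Real.log_pos (one_lt_two (α := ℝ))
  have h0 : 2 * q + d ≠ 0 := by linarith
  rw [Real.rpow_def_of_pos two_pos, Real.sqrt_eq_rpow, Real.rpow_def_of_pos (by positivity), cHatOne]
  congr 1
  field_simp

lemma log_mul_sqrt_div (hT : 2 ≤ T) :
    Real.log T * Real.sqrt (T / Real.log T) = Real.sqrt (T * Real.log T) := by
  have hl := log_nat_pos hT
  rw [← Real.sqrt_sq hl.le, ← Real.sqrt_mul (sq_nonneg _), Real.sqrt_sq hl.le]
  congr 1
  field_simp

/-- The quotient that governs the regret of a batch depends on `T` as for the unrounded radii, whatever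
the index of the batch. -/
lemma rpow_div_rpow_le {Δ : ℝ} (hΔ : 0 < Δ) (hq : 1 ≤ q) (hd : 0 ≤ d) (hT : 2 ≤ T) {p m : ℕ}
    (h : MayFollow q d T p m) :
    roundedRadius Δ q d T p ^ (q + d) / roundedRadius Δ q d T m ^ (2 * q + d) ≤
      (4 ^ q / Δ ^ q) * 2 ^ d * Real.sqrt (T / Real.log T) := by
  rw [roundedRadius_eq_rpow, roundedRadius_eq_rpow, Real.mul_rpow hΔ.le (by positivity),
    Real.mul_rpow hΔ.le (by positivity), ← Real.rpow_mul two_pos.le, ← Real.rpow_mul two_pos.le,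
    mul_div_mul_comm, ← Real.rpow_sub hΔ, ← Real.rpow_sub two_pos]
  have e1 : Δ ^ (q + d - (2 * q + d)) = 1 / Δ ^ q := by
    rw [show q + d - (2 * q + d) = -q by ring, Real.rpow_neg hΔ.le, one_div]
  have e2 : (2 : ℝ) ^ (-(radiusExp q d T p : ℝ) * (q + d) -
      -(radiusExp q d T m : ℝ) * (2 * q + d)) ≤ Real.sqrt (T / Real.log T) * (4 ^ q * 2 ^ d) := by
    have h4 : (4 : ℝ) ^ q = 2 ^ (2 * q) := by
      rw [Real.rpow_mul two_pos.le]
      norm_num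
    rw [← two_rpow_mul_cHatOne hq hd hT, h4, ← Real.rpow_add two_pos, ← Real.rpow_add two_pos]
    apply Real.rpow_le_rpow_of_exponent_le one_le_two
    linarith [h.2]
  rw [e1]
  calc _ ≤ 1 / Δ ^ q * (Real.sqrt (T / Real.log T) * (4 ^ q * 2 ^ d)) := by gcongr
    _ = _ := by ring

/-- The last radius is small enough for a cleanup that uses all `T` steps. -/
lemma mul_roundedRadius_last_le {Δ : ℝ} (hΔ : 0 < Δ) (hq : 1 ≤ q) (hd : 0 ≤ d) (hT : 2 ≤ T) :
    T * roundedRadius Δ q d T (2 * halfBatches q d T) ^ q ≤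
      Δ ^ q * Real.exp 1 * Real.sqrt (T * Real.log T) := by
  set M := halfBatches q d T
  have hl := log_nat_pos hT
  have hT0 : (0 : ℝ) < T := by positivity
  rw [roundedRadius_eq_rpow, Real.mul_rpow hΔ.le (by positivity), ← Real.rpow_mul two_pos.le,
    radiusExp_two_mul]
  have h1 : (2 : ℝ) ^ (-(⌈cHatSum q d T M⌉₊ : ℝ) * q) ≤
      2 ^ ((2 * q + d) * cHatOne q d T * etaHat q d ^ M - (2 * q + d) * cHatOne q d T) := by
    apply Real.rpow_le_rpow_of_exponent_le one_le_two
    have h2 := mul_cHatSum hq hd T M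
    have h3 := mul_le_mul_of_nonneg_left (Nat.le_ceil (cHatSum q d T M)) (show 0 ≤ q by linarith)
    linarith
  rw [Real.rpow_sub two_pos, two_rpow_mul_cHatOne hq hd hT] at h1
  have h2 : (2 : ℝ) ^ ((2 * q + d) * cHatOne q d T * etaHat q d ^ M) ≤ Real.exp 1 := by
    rw [Real.rpow_def_of_pos two_pos, Real.exp_le_exp]
    have h3 := etaHat_pow_halfBatches_le hq hd hT
    have h4 : Real.log 2 * ((2 * q + d) * cHatOne q d T * etaHat q d ^ M) =
        etaHat q d ^ M * Real.log (T / Real.log T) / 2 := by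
      have h2 := Real.log_pos (one_lt_two (α := ℝ))
      have h0 : 2 * q + d ≠ 0 := by linarith
      rw [cHatOne]
      field_simp
    rw [h4]
    linarith
  have hs : 0 < Real.sqrt (T / Real.log T) := Real.sqrt_pos.2 (by positivity)
  have h5 : (T : ℝ) / Real.sqrt (T / Real.log T) = Real.sqrt (T * Real.log T) := by
    rw [← log_mul_sqrt_div hT, div_eq_iff hs.ne', mul_assoc, Real.mul_self_sqrt (by positivity)]
    field_simp
  calc (T : ℝ) * (Δ ^ q * 2 ^ (-(⌈cHatSum q d T M⌉₊ : ℝ) * q))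
      ≤ T * (Δ ^ q * (Real.exp 1 / Real.sqrt (T / Real.log T))) := by
        have := h1.trans (div_le_div_of_nonneg_right h2 hs.le)
        gcongr
    _ = Δ ^ q * Real.exp 1 * (T / Real.sqrt (T / Real.log T)) := by ring
    _ = _ := by rw [h5]

end Radii

/-! ### One batch of the algorithm -/

section Batches

/-- If each member of `l` is played `n` times in a row, then play `i * n + k` is one of member `i`. -/
lemma getElem?_flatMap_replicate {α : Type*} (l : List α) (n i k : ℕ) (hk : k < n) :
    (l.flatMap fun x => List.replicate n x)[i * n + k]? = l[i]? := by
  induction l generalizing i with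
  | nil => simp
  | cons a l ih =>
    rw [List.flatMap_cons]
    cases i with
    | zero =>
      rw [List.getElem?_append_left (by simpa using hk)]
      simp [hk]
    | succ i =>
      rw [List.getElem?_append_right (by simp; nlinarith), List.length_replicate,
        show (i + 1) * n + k - n = i * n + k by rw [add_mul, one_mul]; omega, ih]
      simp

lemma length_flatMap_replicate {α : Type*} (l : List α) (n : ℕ) :
    (l.flatMap fun x => List.replicate n x).length = l.length * n := by
  induction l with
  | nil => simp
  | cons a l ih => simp [List.flatMap_cons, ih, add_mul, add_comm]

variable {X : Type*} [MetricSpace X]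

/-- The centres of the balls `𝒜ₘᵖʳᵉ` of batch `m`, started from state `s`. -/
noncomputable def batchBalls (q Δ : ℝ) (T : ℕ) (ch : GNChoices X) (m : ℕ) (s : GNState X) :
    List X :=
  ch.cover m s.rad (roundedRadius Δ q (doublingDim X) T m) s.region

/-- The end point of batch `m`, started from state `s`. -/
noncomputable def batchEnd (lam q Δ : ℝ) (T : ℕ) (ch : GNChoices X) (m : ℕ) (s : GNState X) : ℕ :=
  s.time + (batchBalls q Δ T ch m s).length * pullsPerBall lam Δ q (doublingDim X) T m

/-- The average observed losses of the balls of batch `m`, started from state `s`. -/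
noncomputable def batchLoss (lam q Δ : ℝ) (T : ℕ) (ch : GNChoices X) (loss : ℕ → X → ℝ) (m : ℕ)
    (s : GNState X) : Fin (batchBalls q Δ T ch m s).length → ℝ :=
  avgLoss loss s.time (pullsPerBall lam Δ q (doublingDim X) T m) (batchBalls q Δ T ch m s)

/-- The centre of the ball `Bₘᵐⁱⁿ` of smallest average loss. -/
noncomputable def bestBall (lam q Δ : ℝ) (T : ℕ) (ch : GNChoices X) (loss : ℕ → X → ℝ) (m : ℕ)
    (s : GNState X) : X :=
  ch.tie m {x | ∃ i, x = (batchBalls q Δ T ch m s).get i ∧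
    ∀ j, batchLoss lam q Δ T ch loss m s i ≤ batchLoss lam q Δ T ch loss m s j}

/-- The centres of the balls that survive batch `m`. -/
def keptBalls (lam L q Δ : ℝ) (T : ℕ) (ch : GNChoices X) (loss : ℕ → X → ℝ) (m : ℕ)
    (s : GNState X) : Set X :=
  {x | x ∈ batchBalls q Δ T ch m s ∧
    supDist (Metric.closedBall x (roundedRadius Δ q (doublingDim X) T m))
      (Metric.closedBall (bestBall lam q Δ T ch loss m s)
        (roundedRadius Δ q (doublingDim X) T m)) ≤
      (3 + ((lam + L) / lam) ^ (1 / q)) * roundedRadius Δ q (doublingDim X) T m}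

/-- The state after batch `m`. -/
noncomputable def nextState (lam L q Δ : ℝ) (T : ℕ) (ch : GNChoices X) (loss : ℕ → X → ℝ) (m : ℕ)
    (s : GNState X) : GNState X where
  time := batchEnd lam q Δ T ch m s
  rad := roundedRadius Δ q (doublingDim X) T m
  region := ⋃ x ∈ keptBalls lam L q Δ T ch loss m s,
    Metric.closedBall x (roundedRadius Δ q (doublingDim X) T m)
  arms := s.arms ++ (batchBalls q Δ T ch m s).flatMap fun x =>
    List.replicate (pullsPerBall lam Δ q (doublingDim X) T m) x
  points := s.points ++ [batchEnd lam q Δ T ch m s]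

variable {lam L q Δ : ℝ} {T : ℕ} {ch : GNChoices X} {loss loss' : ℕ → X → ℝ} {m p : ℕ}
  {ms : List ℕ} {s : GNState X}

lemma gnLoop_cons :
    gnLoop lam L q Δ T ch loss (m :: ms) s =
      if T ≤ batchEnd lam q Δ T ch m s then s
      else gnLoop lam L q Δ T ch loss ms (nextState lam L q Δ T ch loss m s) := rfl

lemma pullsPerBall_pos (hlam : 0 < lam) (hΔ : 0 < Δ) (hT : 2 ≤ T) (d : ℝ) (m : ℕ) :
    0 < pullsPerBall lam Δ q d T m := by
  have h1 := roundedRadius_pos hΔ q d T m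
  have h2 := log_nat_pos hT
  exact Nat.ceil_pos.2 (by positivity)

/-- The properties of the states reached by the algorithm that hold whatever the losses are; `p` is
the index of the last batch, or `0` at the start. -/
structure IsReachable (q Δ : ℝ) (T : ℕ) (s : GNState X) (p : ℕ) : Prop where
  rad_eq : s.rad = roundedRadius Δ q (doublingDim X) T p
  length_arms : s.arms.length = s.time
  time_lt : s.time < T
  nonempty : s.region.Nonempty
  head : s.points.head? = some 0
  le_time : ∀ a ∈ s.points, a ≤ s.time
  increasing : s.points.Pairwise (· < ·)

lemma isReachable_start [Nonempty X] (hT : 2 ≤ T) :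
    IsReachable q Δ T
      { time := 0, rad := Δ, region := (Set.univ : Set X), arms := [], points := [0] } 0 where
  rad_eq := (roundedRadius_zero Δ q _ T).symm
  length_arms := rfl
  time_lt := by simp; omega
  nonempty := Set.univ_nonempty
  head := rfl
  le_time := by simp
  increasing := by simp

lemma three_le_threshold (hlam : 0 < lam) (hL : lam ≤ L) (q : ℝ) :
    3 ≤ 3 + ((lam + L) / lam) ^ (1 / q) := by
  have : 0 ≤ (lam + L) / lam := by
    apply div_nonneg <;> linarith
  have := Real.rpow_nonneg this (1 / q)
  linarith

lemma supDist_closedBall_le {x y : X} {r : ℝ} (hr : 0 ≤ r) :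
    supDist (Metric.closedBall x r) (Metric.closedBall y r) ≤ dist x y + 2 * r := by
  refine Real.sSup_le ?_ (by positivity)
  rintro _ ⟨a, ha, b, hb, rfl⟩
  rw [Metric.mem_closedBall] at ha hb
  have h1 := dist_triangle4 a x y b
  rw [dist_comm y b] at h1
  linarith

section

variable [CompactSpace X]

lemma IsReachable.isRefinement (h : IsReachable q Δ T s p) (hX : IsDoublingSpace X)
    (hΔ : 0 < Δ) (hpm : MayFollow q (doublingDim X) T p m) :
    IsRefinement (roundedRadius Δ q (doublingDim X) T p) (roundedRadius Δ q (doublingDim X) T m)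
      s.region (batchBalls q Δ T ch m s) := by
  have : Nonempty X := h.nonempty.to_type
  rw [batchBalls, h.rad_eq]
  apply ch.cover_spec
  rw [roundedRadius_eq, roundedRadius_eq]
  exact exists_isRefinement hX hΔ hpm.1 _

lemma IsReachable.batchBalls_ne_nil (h : IsReachable q Δ T s p) (hX : IsDoublingSpace X)
    (hΔ : 0 < Δ) (hpm : MayFollow q (doublingDim X) T p m) :
    batchBalls q Δ T ch m s ≠ [] := by
  intro hnil
  obtain ⟨y, hy⟩ := h.nonempty
  have := (h.isRefinement (ch := ch) hX hΔ hpm).covers hy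
  simp [hnil] at this

/-- `tie_spec` applies, since some ball of the nonempty batch has the smallest average loss. -/
lemma IsReachable.bestBall_spec (h : IsReachable q Δ T s p) (hX : IsDoublingSpace X)
    (hΔ : 0 < Δ) (hpm : MayFollow q (doublingDim X) T p m) :
    ∃ i, bestBall lam q Δ T ch loss m s = (batchBalls q Δ T ch m s).get i ∧
      ∀ j, batchLoss lam q Δ T ch loss m s i ≤ batchLoss lam q Δ T ch loss m s j := by
  refine ch.tie_spec m {x | ∃ i, x = (batchBalls q Δ T ch m s).get i ∧
    ∀ j, batchLoss lam q Δ T ch loss m s i ≤ batchLoss lam q Δ T ch loss m s j} ?_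
  have : Nonempty (Fin (batchBalls q Δ T ch m s).length) :=
    ⟨⟨0, List.length_pos_iff.2 (h.batchBalls_ne_nil hX hΔ hpm)⟩⟩
  obtain ⟨i, hi⟩ := Finite.exists_min (batchLoss lam q Δ T ch loss m s)
  exact ⟨_, i, rfl, hi⟩

lemma dist_le_supDist {S S' : Set X} {x y : X} (hx : x ∈ S) (hy : y ∈ S') :
    dist x y ≤ supDist S S' := by
  refine le_csSup ⟨Metric.diam (Set.univ : Set X), ?_⟩ ⟨x, hx, y, hy, rfl⟩
  rintro _ ⟨a, -, b, -, rfl⟩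
  exact Metric.dist_le_diam_of_mem isCompact_univ.isBounded (Set.mem_univ a) (Set.mem_univ b)

/-- Communication points increase strictly since no batch is empty, and the region stays nonempty
since the best-looking ball is never discarded. -/
lemma IsReachable.next (h : IsReachable q Δ T s p) (hX : IsDoublingSpace X) (hlam : 0 < lam)
    (hL : lam ≤ L) (hΔ : 0 < Δ) (hT : 2 ≤ T) (hpm : MayFollow q (doublingDim X) T p m)
    (hend : batchEnd lam q Δ T ch m s < T) :
    IsReachable q Δ T (nextState lam L q Δ T ch loss m s) m := by
  have hlt : s.time < batchEnd lam q Δ T ch m s := by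
    have h1 := List.length_pos_iff.2 (h.batchBalls_ne_nil (ch := ch) hX hΔ hpm)
    have h2 := pullsPerBall_pos (q := q) hlam hΔ hT (doublingDim X) m
    have := Nat.mul_pos h1 h2
    rw [batchEnd]
    omega
  refine ⟨rfl, ?_, hend, ?_, ?_, ?_, ?_⟩
  · simp only [nextState, List.length_append, length_flatMap_replicate, h.length_arms, batchEnd]
  · obtain ⟨i, hi, -⟩ := h.bestBall_spec (lam := lam) (ch := ch) (loss := loss) hX hΔ hpm
    have hr := roundedRadius_pos hΔ q (doublingDim X) T m
    refine ⟨bestBall lam q Δ T ch loss m s, Set.mem_iUnion₂.2 ⟨_, ⟨?_, ?_⟩,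
      Metric.mem_closedBall_self hr.le⟩⟩
    · rw [hi]
      exact List.get_mem _ _
    · refine (supDist_closedBall_le hr.le).trans ?_
      rw [dist_self, zero_add]
      have := three_le_threshold hlam hL q
      gcongr
      linarith
  · have := h.head
    rw [List.head?_eq_some_iff] at this
    obtain ⟨l, hl⟩ := this
    simp [nextState, hl]
  · intro a ha
    simp only [nextState, List.mem_append, List.mem_singleton] at ha
    rcases ha with ha | rfl
    · exact (h.le_time a ha).trans hlt.le
    · exact le_rfl
  · rw [nextState, List.pairwise_append]
    refine ⟨h.increasing, by simp, ?_⟩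
    intro a ha b hb
    rw [List.mem_singleton.1 hb]
    exact (h.le_time a ha).trans_lt hlt

lemma IsReachable.gnLoop (h : IsReachable q Δ T s p) (hX : IsDoublingSpace X) (hlam : 0 < lam)
    (hL : lam ≤ L) (hΔ : 0 < Δ) (hT : 2 ≤ T)
    (hms : (p :: ms).IsChain (MayFollow q (doublingDim X) T)) :
    ∃ p', IsReachable q Δ T (gnLoop lam L q Δ T ch loss ms s) p' := by
  induction ms generalizing s p with
  | nil => exact ⟨p, h⟩
  | cons m ms ih =>
    rw [List.isChain_cons_cons] at hms
    rw [gnLoop_cons]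
    split_ifs with hend
    · exact ⟨p, h⟩
    · exact ih (h.next hX hlam hL hΔ hT hms.1 (not_le.1 hend)) hms.2

end

/-! ### Batched feedback -/

lemma points_prefix_gnLoop : s.points <+: (gnLoop lam L q Δ T ch loss ms s).points := by
  induction ms generalizing s with
  | nil => exact List.prefix_rfl
  | cons m ms ih =>
    rw [gnLoop_cons]
    split_ifs
    · exact List.prefix_rfl
    · exact .trans (List.prefix_append _ _) (ih (s := nextState lam L q Δ T ch loss m s))

lemma length_points_gnLoop_le :
    (gnLoop lam L q Δ T ch loss ms s).points.length ≤ s.points.length + ms.length := by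
  induction ms generalizing s with
  | nil => exact le_rfl
  | cons m ms ih =>
    rw [gnLoop_cons]
    split_ifs
    · omega
    · refine ih.trans ?_
      simp [nextState]
      omega

lemma length_gnGrid_le (M : ℕ) : (gnGrid lam L q Δ T M ch loss).length ≤ 2 * M + 2 := by
  have h1 := length_points_gnLoop_le (lam := lam) (L := L) (q := q) (Δ := Δ) (T := T) (ch := ch)
    (loss := loss) (ms := batchIndices Δ q (doublingDim X) T M)
    (s := { time := 0, rad := Δ, region := Set.univ, arms := [], points := [0] })
  have h2 := length_batchIndices_le Δ q (doublingDim X) T M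
  rw [gnGrid, gnFinal, List.length_append]
  simp only [List.length_singleton] at h1 ⊢
  omega

lemma arms_prefix_gnLoop : s.arms <+: (gnLoop lam L q Δ T ch loss ms s).arms := by
  induction ms generalizing s with
  | nil => exact List.prefix_rfl
  | cons m ms ih =>
    rw [gnLoop_cons]
    split_ifs
    · exact List.prefix_rfl
    · exact .trans (List.prefix_append _ _) (ih (s := nextState lam L q Δ T ch loss m s))

lemma getD_arms_gnLoop {t : ℕ} (ht : t < s.arms.length) (x : X) :
    (gnLoop lam L q Δ T ch loss ms s).arms.getD t x = s.arms[t] := by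
  obtain ⟨l, hl⟩ := arms_prefix_gnLoop (lam := lam) (L := L) (q := q) (Δ := Δ) (T := T) (ch := ch)
    (loss := loss) (ms := ms) (s := s)
  rw [← hl, List.getD_append _ _ _ _ ht, List.getD_eq_getElem _ _ ht]

variable [CompactSpace X]

lemma gnLoop_pairwise (h : IsReachable q Δ T s p) (hX : IsDoublingSpace X) (hlam : 0 < lam)
    (hL : lam ≤ L) (hΔ : 0 < Δ) (hT : 2 ≤ T)
    (hms : (p :: ms).IsChain (MayFollow q (doublingDim X) T)) :
    ((gnLoop lam L q Δ T ch loss ms s).points ++ [T]).Pairwise (· < ·) := by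
  obtain ⟨p', h'⟩ := h.gnLoop (ch := ch) (loss := loss) hX hlam hL hΔ hT hms
  refine List.pairwise_append.2 ⟨h'.increasing, by simp, fun a ha b hb => ?_⟩
  rw [List.mem_singleton.1 hb]
  exact (h'.le_time a ha).trans_lt h'.time_lt

/-- A state determines the next communication point and the arms up to it, and the losses of these
arms determine the next state. -/
lemma gnLoop_nonanticipating (h : IsReachable q Δ T s p) (hX : IsDoublingSpace X)
    (hlam : 0 < lam) (hL : lam ≤ L) (hΔ : 0 < Δ) (hT : 2 ≤ T)
    (hms : (p :: ms).IsChain (MayFollow q (doublingDim X) T)) {j a b : ℕ}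
    (hj : s.points.length ≤ j + 1)
    (ha : ((gnLoop lam L q Δ T ch loss ms s).points ++ [T])[j]? = some a)
    (hb : ((gnLoop lam L q Δ T ch loss ms s).points ++ [T])[j + 1]? = some b)
    (hloss : ∀ t < a, ∀ x, x = (gnLoop lam L q Δ T ch loss ms s).arms.getD t
      (ch.clean t (gnLoop lam L q Δ T ch loss ms s).region) → loss' t x = loss t x) :
    ((gnLoop lam L q Δ T ch loss' ms s).points ++ [T])[j + 1]? = some b ∧
      ∀ t < b, (gnLoop lam L q Δ T ch loss' ms s).arms.getD t
          (ch.clean t (gnLoop lam L q Δ T ch loss' ms s).region) =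
        (gnLoop lam L q Δ T ch loss ms s).arms.getD t
          (ch.clean t (gnLoop lam L q Δ T ch loss ms s).region) := by
  induction ms generalizing s p with
  | nil => exact ⟨hb, fun _ _ => rfl⟩
  | cons m ms ih =>
    rw [List.isChain_cons_cons] at hms
    simp only [gnLoop_cons] at ha hb hloss ⊢
    split_ifs at ha hb hloss ⊢ with hend
    · exact ⟨hb, fun _ _ => rfl⟩
    have hnext := fun l : ℕ → X → ℝ =>
      h.next (loss := l) hX hlam hL hΔ hT hms.1 (not_le.1 hend)
    have hpt : ∀ l : ℕ → X → ℝ, ((gnLoop lam L q Δ T ch l ms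
        (nextState lam L q Δ T ch l m s)).points ++ [T])[s.points.length]? =
        some (batchEnd lam q Δ T ch m s) := by
      intro l
      obtain ⟨k, hk⟩ := points_prefix_gnLoop (lam := lam) (L := L) (q := q) (Δ := Δ) (T := T)
        (ch := ch) (loss := l) (ms := ms) (s := nextState lam L q Δ T ch l m s)
      rw [← hk]
      simp [nextState]
    rcases hj.eq_or_lt with hj | hj
    -- `b` is the end of the current batch, whose arms do not depend on the losses.
    · rw [← hj, hpt] at hb
      rw [← hj, hpt]
      refine ⟨hb, fun t ht => ?_⟩
      have hlt : ∀ l : ℕ → X → ℝ, t < (nextState lam L q Δ T ch l m s).arms.length := fun l => by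
        rw [(hnext l).length_arms]
        exact ht.trans_eq (Option.some.inj hb).symm
      rw [getD_arms_gnLoop (hlt _), getD_arms_gnLoop (hlt _)]
      rfl
    -- The losses agree throughout the current batch, so both runs reach the same next state.
    · have hpw := gnLoop_pairwise (ch := ch) (loss := loss) (hnext loss) hX hlam hL hΔ hT hms.2
      have hle : batchEnd lam q Δ T ch m s ≤ a := by
        obtain ⟨h1, h1'⟩ := List.getElem?_eq_some_iff.1 (hpt loss)
        obtain ⟨h2, h2'⟩ := List.getElem?_eq_some_iff.1 ha
        rw [← h1', ← h2']
        rcases (Nat.lt_succ_iff.1 hj).eq_or_lt with h3 | h3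
        · simp only [h3, le_refl]
        · exact (List.pairwise_iff_getElem.1 hpw _ _ h1 h2 h3).le
      have hbl : batchLoss lam q Δ T ch loss' m s = batchLoss lam q Δ T ch loss m s := by
        funext i
        unfold batchLoss avgLoss
        congr 1
        refine Finset.sum_congr rfl fun k hk => ?_
        rw [Finset.mem_range] at hk
        have hi : s.time + i * pullsPerBall lam Δ q (doublingDim X) T m + k <
            batchEnd lam q Δ T ch m s := by
          have := Nat.mul_le_mul_right (pullsPerBall lam Δ q (doublingDim X) T m)
            (Nat.succ_le_of_lt i.2)
          rw [Nat.succ_mul] at this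
          rw [batchEnd]
          omega
        refine hloss _ (hi.trans_le hle) _ ?_
        have hi' := hi.trans_eq (hnext loss).length_arms.symm
        rw [getD_arms_gnLoop hi', eq_comm, ← Option.some_inj, ← List.getElem?_eq_getElem hi']
        simp only [nextState]
        rw [List.getElem?_append_right (by rw [h.length_arms]; omega), h.length_arms,
          show s.time + i * pullsPerBall lam Δ q (doublingDim X) T m + k - s.time =
            i * pullsPerBall lam Δ q (doublingDim X) T m + k by omega,
          getElem?_flatMap_replicate _ _ _ _ hk]
        simp
      have hns : nextState lam L q Δ T ch loss' m s = nextState lam L q Δ T ch loss m s := by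
        simp only [nextState, keptBalls, bestBall, hbl]
      rw [hns]
      exact ih (hnext loss) hms.2 (by simpa [nextState] using hj) ha hb hloss

lemma isBatchedRun_gnArm [Nonempty X] (hX : IsDoublingSpace X)
    (hlam : 0 < lam) (hL : lam ≤ L) (hq : 1 ≤ q) (hΔ : 0 < Δ) (hT : 2 ≤ T) (M : ℕ) :
    IsBatchedRun T (gnArm lam L q Δ T M ch) (gnGrid lam L q Δ T M ch) where
  head loss := by
    obtain ⟨p, hp⟩ := (isReachable_start (X := X) hT).gnLoop (ch := ch) (loss := loss) hX hlam hL hΔ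
      hT (batchIndices_spec hΔ hq (doublingDim_nonneg hX) hT M).1
    obtain ⟨l, hl⟩ := List.head?_eq_some_iff.1 hp.head
    rw [gnGrid, gnFinal, hl]
    simp
  last loss := by simp [gnGrid]
  increasing loss := gnLoop_pairwise (isReachable_start hT) hX hlam hL hΔ hT
    (batchIndices_spec hΔ hq (doublingDim_nonneg hX) hT M).1
  nonanticipating loss loss' j a b ha hb hloss :=
    gnLoop_nonanticipating (isReachable_start hT) hX hlam hL hΔ hT
      (batchIndices_spec hΔ hq (doublingDim_nonneg hX) hT M).1 (by simp) ha hb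
      fun t ht x hx => hx ▸ hloss t ht

end Batches

/-! ### Concentration of the noise -/

section Noise

/-- Any two disjoint windows of `n` steps have noise sums that differ by less than
`4 √(n log T)`. -/
def NoiseGood (T : ℕ) (e : ℕ → ℝ) : Prop :=
  ∀ n ∈ Finset.Ico 1 T, ∀ s ∈ Finset.range T, ∀ s' ∈ Finset.range T, s + n ≤ s' ∨ s' + n ≤ s →
    ∑ k ∈ Finset.range n, e (s + k) - ∑ k ∈ Finset.range n, e (s' + k) <
      4 * Real.sqrt (n * Real.log T)

variable {Ω : Type*} [MeasurableSpace Ω] {μ : Measure Ω} {ε : ℕ → Ω → ℝ}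

lemma measureReal_window_diff_ge_le (h : IsSubgaussianNoise μ ε)
    {T n s s' : ℕ} (hT : 2 ≤ T) (hn : 1 ≤ n) (hs : s + n ≤ s' ∨ s' + n ≤ s) :
    μ.real {ω | 4 * Real.sqrt (n * Real.log T) ≤
      ∑ k ∈ Finset.range n, ε (s + k) ω - ∑ k ∈ Finset.range n, ε (s' + k) ω} ≤
      1 / (T : ℝ) ^ 4 := by
  have hlog := log_nat_pos hT
  have hn0 : (0 : ℝ) < n := by exact_mod_cast hn
  -- The difference is a sum of `2 n` independent variables `± ε t`.
  set W := (Finset.range n).map (addLeftEmbedding s) with hW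
  set W' := (Finset.range n).map (addLeftEmbedding s') with hW'
  have hdisj : Disjoint W W' := by
    rw [Finset.disjoint_left]
    intro a ha ha'
    simp only [hW, hW', Finset.mem_map, Finset.mem_range, addLeftEmbedding_apply] at ha ha'
    omega
  let g : ℕ → ℝ → ℝ := fun t y => if t ∈ W then y else -y
  have hg : ∀ t, Measurable (g t) := fun t => by
    simp only [g]
    split_ifs
    · exact measurable_id
    · exact measurable_neg
  have hind : iIndepFun (fun t => g t ∘ ε t) μ := h.indep.comp g hg
  have hsub : ∀ t ∈ W ∪ W', HasSubgaussianMGF (g t ∘ ε t) 1 μ := fun t _ => by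
    by_cases ht : t ∈ W
    · simpa [g, ht, Function.comp_def] using h.subgaussian t
    · have := (h.subgaussian t).neg
      simpa [g, ht, Function.comp_def, Pi.neg_def] using this
  have hmain := HasSubgaussianMGF.measure_sum_ge_le_of_iIndepFun hind hsub
    (ε := 4 * Real.sqrt (n * Real.log T)) (by positivity)
  have hsum : ∀ ω, ∑ t ∈ W ∪ W', (g t ∘ ε t) ω =
      ∑ k ∈ Finset.range n, ε (s + k) ω - ∑ k ∈ Finset.range n, ε (s' + k) ω := by
    intro ω
    rw [Finset.sum_union hdisj, sub_eq_add_neg, ← Finset.sum_neg_distrib]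
    congr 1
    · rw [Finset.sum_congr rfl fun t ht => show (g t ∘ ε t) ω = ε t ω by simp [g, ht], hW,
        Finset.sum_map]
      rfl
    · rw [Finset.sum_congr rfl fun t ht => show (g t ∘ ε t) ω = -ε t ω by
        simp [g, Finset.disjoint_right.1 hdisj ht], hW', Finset.sum_map]
      rfl
  simp_rw [hsum] at hmain
  refine hmain.trans_eq ?_
  have hcard : (W ∪ W').card = 2 * n := by
    rw [Finset.card_union_of_disjoint hdisj, hW, hW', Finset.card_map, Finset.card_map,
      Finset.card_range, two_mul]
  have hc : ((∑ i ∈ W ∪ W', (1 : ℝ≥0) : ℝ≥0) : ℝ) = 2 * n := by simp [hcard]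
  have hexp : -(4 * Real.sqrt (n * Real.log T)) ^ 2 / (2 * (2 * n)) = -((4 : ℕ) * Real.log T) := by
    rw [mul_pow, Real.sq_sqrt (by positivity)]
    field_simp
    norm_num
  push_cast at hc ⊢
  rw [hc, hexp, Real.exp_neg, Real.exp_nat_mul, Real.exp_log (by positivity), one_div]

lemma measurableSet_noiseGood (h : IsSubgaussianNoise μ ε) (T : ℕ) :
    MeasurableSet {ω | NoiseGood T fun t => ε t ω} := by
  have hm := h.measurable
  simp only [NoiseGood, Set.ofPred_forall]
  refine Finset.measurableSet_biInter _ fun n _ => Finset.measurableSet_biInter _ fun s _ =>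
    Finset.measurableSet_biInter _ fun s' _ => MeasurableSet.iInter fun _ => ?_
  exact measurableSet_lt (by fun_prop) measurable_const

/-- A union bound over the lengths and the deterministic positions of two windows; since differences
of two windows concentrate with failure probability `T ^ (-4)`, no conditioning on the adaptively
chosen starting times of the batches is needed. -/
lemma lt_measureReal_noiseGood [IsProbabilityMeasure μ] (h : IsSubgaussianNoise μ ε) {T : ℕ}
    (hT : 2 ≤ T) : 1 - 2 / (T : ℝ) < μ.real {ω | NoiseGood T fun t => ε t ω} := by
  have hT0 : (0 : ℝ) < T := by positivity
  set bad : ℕ × ℕ × ℕ → Set Ω := fun x => {ω | (x.2.1 + x.1 ≤ x.2.2 ∨ x.2.2 + x.1 ≤ x.2.1) ∧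
    4 * Real.sqrt (x.1 * Real.log T) ≤ ∑ k ∈ Finset.range x.1, ε (x.2.1 + k) ω -
      ∑ k ∈ Finset.range x.1, ε (x.2.2 + k) ω} with hbad
  set I := Finset.Ico 1 T ×ˢ Finset.range T ×ˢ Finset.range T with hI
  have hsub : {ω | NoiseGood T fun t => ε t ω}ᶜ ⊆ ⋃ x ∈ I, bad x := by
    intro ω hω
    simp only [Set.mem_compl_iff, Set.mem_ofPred_eq, NoiseGood] at hω
    push Not at hω
    obtain ⟨n, hn, s, hs, s', hs', h1, h2⟩ := hω
    exact Set.mem_iUnion₂.2 ⟨(n, s, s'),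
      Finset.mem_product.2 ⟨hn, Finset.mem_product.2 ⟨hs, hs'⟩⟩, h1, h2⟩
  have hle : ∀ x ∈ I, μ.real (bad x) ≤ 1 / (T : ℝ) ^ 4 := by
    rintro ⟨n, s, s'⟩ hx
    have hn := (Finset.mem_Ico.1 (Finset.mem_product.1 hx).1).1
    by_cases hs : s + n ≤ s' ∨ s' + n ≤ s
    · simpa [hbad, hs] using measureReal_window_diff_ge_le h hT hn hs
    · simp [hbad, hs]
  have hcard : (I.card : ℝ) = (T - 1) * (T * T) := by
    rw [hI, Finset.card_product, Finset.card_product, Nat.card_Ico, Finset.card_range]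
    push_cast [Nat.cast_sub (show 1 ≤ T by omega)]
    ring
  have hcompl : μ.real {ω | NoiseGood T fun t => ε t ω}ᶜ ≤ (T - 1) * (T * T) / (T : ℝ) ^ 4 := by
    calc _ ≤ μ.real (⋃ x ∈ I, bad x) := measureReal_mono hsub (measure_ne_top _ _)
      _ ≤ ∑ x ∈ I, μ.real (bad x) := measureReal_biUnion_finset_le _ _
      _ ≤ ∑ x ∈ I, 1 / (T : ℝ) ^ 4 := Finset.sum_le_sum hle
      _ = _ := by rw [Finset.sum_const, nsmul_eq_mul, hcard]; ring
  rw [probReal_compl_eq_one_sub (measurableSet_noiseGood h T)] at hcompl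
  have hlt : ((T : ℝ) - 1) * (T * T) / (T : ℝ) ^ 4 < 2 / T := by
    rw [div_lt_div_iff₀ (by positivity) hT0]
    have : (0 : ℝ) < T ^ 3 := by positivity
    nlinarith
  linarith

end Noise

/-! ### Regret on the good event -/

section Regret

lemma sum_range_getD {α : Type*} (l : List α) (c : ℕ → α) (g : α → ℝ) :
    ∑ t ∈ Finset.range l.length, g (l.getD t (c t)) = (l.map g).sum := by
  induction l generalizing c with
  | nil => simp
  | cons a l ih =>
    rw [List.length_cons, Finset.sum_range_succ', List.map_cons, List.sum_cons, add_comm]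
    congr 1
    exact ih fun t => c (t + 1)

lemma avgLoss_eq {α : Type*} (f : α → ℝ) (e : ℕ → ℝ) {n : ℕ} (hn : 0 < n) (t : ℕ) (l : List α)
    (i : Fin l.length) :
    avgLoss (fun t x => f x + e t) t n l i =
      f (l.get i) + (∑ k ∈ Finset.range n, e (t + i * n + k)) / n := by
  have : (n : ℝ) ≠ 0 := by positivity
  rw [avgLoss, Finset.sum_add_distrib, Finset.sum_const, Finset.card_range, nsmul_eq_mul]
  field_simp

variable {X : Type*} [MetricSpace X] {f : X → ℝ} {xs : X} {lam L q Δ : ℝ} {T : ℕ}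
  {ch : GNChoices X} {e : ℕ → ℝ} {m p : ℕ} {ms : List ℕ} {s : GNState X}

/-- The balls of a batch that follows a batch of radius `r` have their centres within distance
`radiusFactor * r` of the minimiser. -/
noncomputable def radiusFactor (lam L q : ℝ) : ℝ := 4 + 2 * ((lam + L) / lam) ^ (1 / q)

/-- Arms within distance `radiusFactor * r` of the minimiser cost at most `lossFactor * r ^ q`. -/
noncomputable def lossFactor (lam L q : ℝ) : ℝ := L * radiusFactor lam L q ^ q

/-- The number of pulls per ball is at most `pullsFactor * log T / r ^ (2 q)`, the rounding
included. -/
noncomputable def pullsFactor (lam Δ q : ℝ) : ℝ := 16 / lam ^ 2 + Δ ^ (2 * q) / Real.log 2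

/-- A bound for the regret of a single batch, if `radiusFactor ≤ 2 ^ J`. -/
noncomputable def batchRegret (lam L q Δ d : ℝ) (J T : ℕ) : ℝ :=
  pullsFactor lam Δ q * lossFactor lam L q * (4 ^ q / Δ ^ q) * (2 ^ (J + 1)) ^ d *
    Real.sqrt (T * Real.log T)

lemma radiusFactor_pos (hlam : 0 < lam) (hL : lam ≤ L) (q : ℝ) : 0 < radiusFactor lam L q := by
  have := three_le_threshold hlam hL q
  rw [radiusFactor]
  linarith

lemma lossFactor_pos (hlam : 0 < lam) (hL : lam ≤ L) (q : ℝ) : 0 < lossFactor lam L q :=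
  mul_pos (by linarith) (Real.rpow_pos_of_pos (radiusFactor_pos hlam hL q) _)

lemma pullsFactor_pos (hlam : 0 < lam) (hΔ : 0 < Δ) (q : ℝ) : 0 < pullsFactor lam Δ q := by
  have := Real.log_pos (one_lt_two (α := ℝ))
  unfold pullsFactor
  positivity

lemma batchRegret_nonneg (hlam : 0 < lam) (hL : lam ≤ L) (hΔ : 0 < Δ) (d : ℝ) (J T : ℕ) :
    0 ≤ batchRegret lam L q Δ d J T := by
  have h1 := lossFactor_pos hlam hL q
  have h2 := pullsFactor_pos hlam hΔ q
  unfold batchRegret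
  positivity

lemma roundedRadius_le {q d : ℝ} (hΔ : 0 < Δ) (T m : ℕ) : roundedRadius Δ q d T m ≤ Δ := by
  rw [roundedRadius_eq]
  exact mul_le_of_le_one_right hΔ.le (pow_le_one₀ (by norm_num) (by norm_num))

lemma pullsPerBall_le {d : ℝ} (hlam : 0 < lam) (hΔ : 0 < Δ) (hq : 1 ≤ q) (hT : 2 ≤ T) (m : ℕ) :
    (pullsPerBall lam Δ q d T m : ℝ) ≤
      pullsFactor lam Δ q * Real.log T / roundedRadius Δ q d T m ^ (2 * q) := by
  have hr := roundedRadius_pos hΔ q d T m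
  have hl := log_nat_pos hT
  have h2 := Real.log_pos (one_lt_two (α := ℝ))
  have hrq : 0 < roundedRadius Δ q d T m ^ (2 * q) := by positivity
  -- The second summand of `pullsFactor` pays for the `+ 1` of the ceiling, as `r ≤ Δ` and `2 ≤ T`.
  have h3 : 1 ≤ Δ ^ (2 * q) / Real.log 2 * Real.log T / roundedRadius Δ q d T m ^ (2 * q) := by
    rw [le_div_iff₀ hrq, one_mul, div_mul_eq_mul_div, le_div_iff₀ h2]
    have h4 : roundedRadius Δ q d T m ^ (2 * q) ≤ Δ ^ (2 * q) :=
      Real.rpow_le_rpow hr.le (roundedRadius_le hΔ T m) (by linarith)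
    have h5 : Real.log 2 ≤ Real.log T := Real.log_le_log two_pos (by exact_mod_cast hT)
    gcongr
  refine (Nat.ceil_lt_add_one (by positivity)).le.trans ?_
  rw [pullsFactor, add_mul, add_div]
  refine add_le_add (le_of_eq ?_) h3
  field_simp

/-- The number of pulls is large enough for the noise of two balls to be comparable. -/
lemma four_mul_sqrt_le (hlam : 0 < lam) (hΔ : 0 < Δ) (hT : 2 ≤ T) (d : ℝ) (m : ℕ) :
    4 * Real.sqrt (pullsPerBall lam Δ q d T m * Real.log T) ≤
      pullsPerBall lam Δ q d T m * (lam * roundedRadius Δ q d T m ^ q) := by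
  have hr := roundedRadius_pos hΔ q d T m
  have hl := log_nat_pos hT
  have hn : 16 * Real.log T / (lam ^ 2 * roundedRadius Δ q d T m ^ (2 * q)) ≤
    pullsPerBall lam Δ q d T m := Nat.le_ceil _
  set n : ℝ := (pullsPerBall lam Δ q d T m : ℝ)
  have hn0 : 0 ≤ n := Nat.cast_nonneg _
  have hsq : roundedRadius Δ q d T m ^ (2 * q) = (roundedRadius Δ q d T m ^ q) ^ 2 := by
    rw [mul_comm, Real.rpow_mul hr.le, Real.rpow_two]
  have hrq : 0 < roundedRadius Δ q d T m ^ q := by positivity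
  rw [hsq, div_le_iff₀ (by positivity)] at hn
  refine abs_le_of_sq_le_sq' ?_ (by positivity) |>.2
  rw [mul_pow, Real.sq_sqrt (by positivity)]
  have := mul_le_mul_of_nonneg_left hn hn0
  linarith

lemma dist_le_of_value_le (hf : IsNondegenerate f xs lam L q) {x : X} {r : ℝ} (hr : 0 ≤ r)
    (h : f x - f xs ≤ (lam + L) * r ^ q) : dist x xs ≤ ((lam + L) / lam) ^ (1 / q) * r := by
  have h1 := hf.lam_pos
  have h2 := hf.lam_le
  have h3 := hf.one_le
  have h4 : dist x xs ^ q ≤ (lam + L) / lam * r ^ q := by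
    rw [div_mul_eq_mul_div, le_div_iff₀ h1, mul_comm]
    exact (hf.lower x).trans h
  have h5 : 0 ≤ (lam + L) / lam := div_nonneg (by linarith) h1.le
  have hq0 : q ≠ 0 := by linarith
  have h6 : (((lam + L) / lam) ^ (1 / q) * r) ^ q = (lam + L) / lam * r ^ q := by
    rw [Real.mul_rpow (by positivity) hr, ← Real.rpow_mul h5, one_div_mul_cancel hq0, Real.rpow_one]
  rw [← h6] at h4
  exact (Real.rpow_le_rpow_iff dist_nonneg (by positivity) (by linarith)).1 h4

lemma value_le_of_dist_le (hf : IsNondegenerate f xs lam L q) {x : X} {r : ℝ} (hr : 0 ≤ r)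
    (h : dist x xs ≤ radiusFactor lam L q * r) : f x - f xs ≤ lossFactor lam L q * r ^ q := by
  have h0 := radiusFactor_pos hf.lam_pos hf.lam_le q
  have h1 := hf.one_le
  have hL : 0 ≤ L := hf.lam_pos.le.trans hf.lam_le
  refine (hf.upper x).trans ?_
  rw [lossFactor, mul_assoc, ← Real.mul_rpow h0.le hr]
  gcongr

/-- The region contains the minimiser and lies close to it on the scale of the current radius. -/
structure IsLocalized (lam L q : ℝ) (xs : X) (s : GNState X) : Prop where
  mem : xs ∈ s.region
  dist_le : ∀ y ∈ s.region, dist y xs ≤ (3 + 2 * ((lam + L) / lam) ^ (1 / q)) * s.rad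

lemma IsLocalized.value_le (h : IsLocalized lam L q xs s) (hf : IsNondegenerate f xs lam L q)
    (hr : 0 ≤ s.rad) {y : X} (hy : y ∈ s.region) :
    f y - f xs ≤ lossFactor lam L q * s.rad ^ q := by
  refine value_le_of_dist_le hf hr ((h.dist_le y hy).trans ?_)
  rw [radiusFactor]
  gcongr
  norm_num

/-- If one ball looks better than another, then its centre is not much worse. -/
lemma NoiseGood.sub_le (hgood : NoiseGood T e) (hlam : 0 < lam) (hΔ : 0 < Δ) (hT : 2 ≤ T)
    (hend : batchEnd lam q Δ T ch m s < T) {i j : Fin (batchBalls q Δ T ch m s).length}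
    (hij : batchLoss lam q Δ T ch (fun t x => f x + e t) m s i ≤
      batchLoss lam q Δ T ch (fun t x => f x + e t) m s j) :
    f ((batchBalls q Δ T ch m s).get i) - f ((batchBalls q Δ T ch m s).get j) ≤
      lam * roundedRadius Δ q (doublingDim X) T m ^ q := by
  have hr := roundedRadius_pos hΔ q (doublingDim X) T m
  -- A ball is compared with itself for free; only distinct balls occupy disjoint windows.
  rcases eq_or_ne i j with rfl | hne
  · rw [sub_self]
    positivity
  have hn := pullsPerBall_pos (q := q) hlam hΔ hT (doublingDim X) m
  have hsq := four_mul_sqrt_le (q := q) hlam hΔ hT (doublingDim X) m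
  rw [batchLoss, avgLoss_eq f e hn, avgLoss_eq f e hn] at hij
  rw [batchEnd] at hend
  set n := pullsPerBall lam Δ q (doublingDim X) T m
  have hn0 : (0 : ℝ) < n := by exact_mod_cast hn
  have hmul : ∀ k : Fin (batchBalls q Δ T ch m s).length,
      k * n + n ≤ (batchBalls q Δ T ch m s).length * n := fun k => by
    have := Nat.mul_le_mul_right n (Nat.succ_le_of_lt k.2)
    rwa [Nat.succ_mul] at this
  have hi := hmul i
  have hj := hmul j
  have hdisj : s.time + j * n + n ≤ s.time + i * n ∨ s.time + i * n + n ≤ s.time + j * n := by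
    rcases lt_or_gt_of_ne hne with h | h
    · have := Nat.mul_le_mul_right n (Nat.succ_le_of_lt (Fin.lt_def.1 h))
      rw [Nat.succ_mul] at this
      omega
    · have := Nat.mul_le_mul_right n (Nat.succ_le_of_lt (Fin.lt_def.1 h))
      rw [Nat.succ_mul] at this
      omega
  have hnoise := hgood n (Finset.mem_Ico.2 ⟨hn, by omega⟩) (s.time + j * n)
    (Finset.mem_range.2 (by omega)) (s.time + i * n) (Finset.mem_range.2 (by omega)) hdisj
  have h1 : (∑ k ∈ Finset.range n, e (s.time + j * n + k)) / n -
      (∑ k ∈ Finset.range n, e (s.time + i * n + k)) / n ≤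
      lam * roundedRadius Δ q (doublingDim X) T m ^ q := by
    rw [← sub_div, div_le_iff₀ hn0]
    linarith
  linarith

variable [CompactSpace X]

/-- The minimiser survives each batch, and the surviving balls are close to it. -/
lemma IsReachable.isLocalized_next (h : IsReachable q Δ T s p) (hloc : IsLocalized lam L q xs s)
    (hf : IsNondegenerate f xs lam L q) (hgood : NoiseGood T e) (hX : IsDoublingSpace X)
    (hΔ : 0 < Δ) (hT : 2 ≤ T) (hpm : MayFollow q (doublingDim X) T p m)
    (hend : batchEnd lam q Δ T ch m s < T) :
    IsLocalized lam L q xs (nextState lam L q Δ T ch (fun t x => f x + e t) m s) := by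
  have hlam := hf.lam_pos
  have hr := roundedRadius_pos hΔ q (doublingDim X) T m
  have hq0 : 0 ≤ q := by linarith [hf.one_le]
  have hL : 0 ≤ L := hlam.le.trans hf.lam_le
  obtain ⟨i, hi, hmin⟩ := h.bestBall_spec (lam := lam) (ch := ch)
    (loss := fun t x => f x + e t) hX hΔ hpm
  obtain ⟨c, hc, hxc⟩ := Set.mem_iUnion₂.1
    ((h.isRefinement (ch := ch) hX hΔ hpm).covers hloc.mem)
  obtain ⟨j, rfl⟩ := List.get_of_mem hc
  -- `j` is a ball that contains the minimiser, so its centre has value at most `L * r ^ q`.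
  have hbest := hgood.sub_le hlam hΔ hT hend (hmin j)
  rw [← hi] at hbest
  set r := roundedRadius Δ q (doublingDim X) T m
  rw [Metric.mem_closedBall] at hxc
  have hcval : f ((batchBalls q Δ T ch m s).get j) - f xs ≤ L * r ^ q := by
    refine (hf.upper _).trans ?_
    rw [dist_comm]
    gcongr
  have hbd : dist (bestBall lam q Δ T ch (fun t x => f x + e t) m s) xs ≤
      ((lam + L) / lam) ^ (1 / q) * r :=
    dist_le_of_value_le hf hr.le (by linarith)
  constructor
  · refine Set.mem_iUnion₂.2 ⟨_, ⟨hc, (supDist_closedBall_le hr.le).trans ?_⟩, hxc⟩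
    have h1 := dist_triangle ((batchBalls q Δ T ch m s).get j) xs
      (bestBall lam q Δ T ch (fun t x => f x + e t) m s)
    rw [dist_comm _ xs, dist_comm xs (bestBall _ _ _ _ _ _ _ _)] at h1
    linarith
  · intro y hy
    obtain ⟨c', ⟨-, hc'⟩, hy'⟩ := Set.mem_iUnion₂.1 hy
    have h1 := (dist_le_supDist hy' (Metric.mem_closedBall_self hr.le)).trans hc'
    have h2 := dist_triangle y (bestBall lam q Δ T ch (fun t x => f x + e t) m s) xs
    change dist y xs ≤ _ * r
    linarith

/-- The number of plays of a batch, times a bound for the regret of each of them. -/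
lemma IsReachable.batch_cost_le (h : IsReachable q Δ T s p) (hloc : IsLocalized lam L q xs s)
    (hX : IsDoublingSpace X) (hlam : 0 < lam) (hL : lam ≤ L) (hq : 1 ≤ q)
    (hΔ : 0 < Δ) (hT : 2 ≤ T) {J : ℕ} (hJ : radiusFactor lam L q ≤ 2 ^ J)
    (hpm : MayFollow q (doublingDim X) T p m) :
    (batchBalls q Δ T ch m s).length * pullsPerBall lam Δ q (doublingDim X) T m *
      (lossFactor lam L q * s.rad ^ q) ≤ batchRegret lam L q Δ (doublingDim X) J T := by
  have : Nonempty X := ⟨xs⟩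
  have hd := doublingDim_nonneg hX
  have hD := lossFactor_pos hlam hL q
  have hP := pullsFactor_pos hlam hΔ q
  have hl := log_nat_pos hT
  have hlen := (h.isRefinement (ch := ch) hX hΔ hpm).card_le
  have hn := pullsPerBall_le (d := doublingDim X) hlam hΔ hq hT m
  have hr := roundedRadius_pos hΔ q (doublingDim X) T m
  have hrp := roundedRadius_pos hΔ q (doublingDim X) T p
  have hquot := rpow_div_rpow_le hΔ hq hd hT hpm
  have hsqrt := log_mul_sqrt_div hT
  have hsub : s.region ⊆ Metric.closedBall xs (2 ^ J * roundedRadius Δ q (doublingDim X) T p) := by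
    intro y hy
    refine Metric.mem_closedBall.2 ((hloc.dist_le y hy).trans ?_)
    rw [h.rad_eq]
    rw [radiusFactor] at hJ
    gcongr
    linarith
  have hcov := toNat_externalCoveringNumber_le hX hrp hsub
  rw [h.rad_eq]
  set d := doublingDim X
  set r := roundedRadius Δ q d T m
  set r₀ := roundedRadius Δ q d T p
  have hrr : (r₀ / r) ^ d * (1 / r ^ (2 * q)) * r₀ ^ q = r₀ ^ (q + d) / r ^ (2 * q + d) := by
    rw [Real.div_rpow hrp.le hr.le, Real.rpow_add hrp, Real.rpow_add hr]
    field_simp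
  have hpow : ((2 : ℝ) ^ J) ^ d * 2 ^ d = (2 ^ (J + 1)) ^ d := by
    rw [← Real.mul_rpow (by positivity) two_pos.le, ← pow_succ]
  calc ((batchBalls q Δ T ch m s).length : ℝ) * pullsPerBall lam Δ q d T m *
        (lossFactor lam L q * r₀ ^ q)
      ≤ ((r₀ / r) ^ d * (2 ^ J) ^ d) * (pullsFactor lam Δ q * Real.log T / r ^ (2 * q)) *
        (lossFactor lam L q * r₀ ^ q) := by
        have := hlen.trans (mul_le_mul_of_nonneg_left hcov (by positivity))
        gcongr
    _ = pullsFactor lam Δ q * lossFactor lam L q * (2 ^ J) ^ d * Real.log T *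
        ((r₀ / r) ^ d * (1 / r ^ (2 * q)) * r₀ ^ q) := by ring
    _ ≤ pullsFactor lam Δ q * lossFactor lam L q * (2 ^ J) ^ d * Real.log T *
        (4 ^ q / Δ ^ q * 2 ^ d * Real.sqrt (T / Real.log T)) := by
        rw [hrr]
        gcongr
    _ = batchRegret lam L q Δ d J T := by
        rw [batchRegret, ← hsqrt, ← hpow]
        ring

lemma IsReachable.value_batchBalls_le (h : IsReachable q Δ T s p)
    (hloc : IsLocalized lam L q xs s) (hf : IsNondegenerate f xs lam L q)
    (hX : IsDoublingSpace X) (hΔ : 0 < Δ) (hpm : MayFollow q (doublingDim X) T p m) {c : X}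
    (hc : c ∈ batchBalls q Δ T ch m s) : f c - f xs ≤ lossFactor lam L q * s.rad ^ q := by
  have hrp := roundedRadius_pos hΔ q (doublingDim X) T p
  obtain ⟨y, hy, hyS⟩ := (h.isRefinement (ch := ch) hX hΔ hpm).meets c hc
  have hle := (roundedRadius_le_iff hΔ q (doublingDim X) T p m).2 hpm.1
  have hyd := hloc.dist_le y hyS
  rw [h.rad_eq] at hyd ⊢
  refine value_le_of_dist_le hf hrp.le ?_
  have h1 := dist_triangle_left c xs y
  rw [Metric.mem_closedBall] at hy
  rw [radiusFactor]
  linarith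

/-- The regret of the arms in a list. -/
def listRegret (f : X → ℝ) (xs : X) (l : List X) : ℝ := (l.map fun x => f x - f xs).sum

lemma IsReachable.listRegret_next_le (h : IsReachable q Δ T s p)
    (hloc : IsLocalized lam L q xs s) (hf : IsNondegenerate f xs lam L q)
    (hX : IsDoublingSpace X) (hΔ : 0 < Δ) (hpm : MayFollow q (doublingDim X) T p m)
    (loss : ℕ → X → ℝ) :
    listRegret f xs (nextState lam L q Δ T ch loss m s).arms ≤ listRegret f xs s.arms +
      (batchBalls q Δ T ch m s).length * pullsPerBall lam Δ q (doublingDim X) T m *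
        (lossFactor lam L q * s.rad ^ q) := by
  simp only [listRegret, nextState, List.map_append, List.sum_append]
  gcongr
  refine (List.sum_le_card_nsmul _ (lossFactor lam L q * s.rad ^ q) ?_).trans_eq ?_
  · intro v hv
    simp only [List.mem_map, List.mem_flatMap, List.mem_replicate] at hv
    obtain ⟨c, ⟨c', hc', -, rfl⟩, rfl⟩ := hv
    exact h.value_batchBalls_le hloc hf hX hΔ hpm hc'
  · rw [List.length_map, length_flatMap_replicate, nsmul_eq_mul, Nat.cast_mul]

/-- The regret of the remaining batches and of a cleanup whose arms are as bad as the final region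
allows. The cleanup costs no more than the batch at which the loop is left or, if all batches are
carried out, at most `B`. -/
lemma gnLoop_regret_le (h : IsReachable q Δ T s p) (hloc : IsLocalized lam L q xs s)
    (hf : IsNondegenerate f xs lam L q) (hgood : NoiseGood T e) (hX : IsDoublingSpace X)
    (hΔ : 0 < Δ) (hT : 2 ≤ T) {J : ℕ} (hJ : radiusFactor lam L q ≤ 2 ^ J)
    (hms : (p :: ms).IsChain (MayFollow q (doublingDim X) T)) {B : ℝ} {last : ℕ}
    (hlast : (p :: ms).getLast? = some last) (hB : 0 ≤ B)
    (hBlast : T * (lossFactor lam L q * roundedRadius Δ q (doublingDim X) T last ^ q) ≤ B) :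
    ∃ p', IsReachable q Δ T (gnLoop lam L q Δ T ch (fun t x => f x + e t) ms s) p' ∧
      IsLocalized lam L q xs (gnLoop lam L q Δ T ch (fun t x => f x + e t) ms s) ∧
      listRegret f xs (gnLoop lam L q Δ T ch (fun t x => f x + e t) ms s).arms +
        (T - (gnLoop lam L q Δ T ch (fun t x => f x + e t) ms s).time) * (lossFactor lam L q *
          (gnLoop lam L q Δ T ch (fun t x => f x + e t) ms s).rad ^ q) ≤
      listRegret f xs s.arms + ms.length * batchRegret lam L q Δ (doublingDim X) J T + B := by
  have hD := lossFactor_pos hf.lam_pos hf.lam_le q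
  have hbr := batchRegret_nonneg (q := q) hf.lam_pos hf.lam_le hΔ (doublingDim X) J T
  induction ms generalizing s p with
  | nil =>
    refine ⟨p, h, hloc, ?_⟩
    simp only [gnLoop, List.length_nil, Nat.cast_zero, zero_mul, add_zero, add_le_add_iff_left]
    obtain rfl : p = last := by simpa using hlast
    rw [h.rad_eq]
    have hrp := roundedRadius_pos hΔ q (doublingDim X) T p
    refine le_trans ?_ hBlast
    gcongr
    simp
  | cons m ms ih =>
    rw [List.isChain_cons_cons] at hms
    have hcost := h.batch_cost_le (ch := ch) hloc hX hf.lam_pos hf.lam_le hf.one_le hΔ hT hJ hms.1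
    have hrad : 0 < s.rad := h.rad_eq ▸ roundedRadius_pos hΔ q (doublingDim X) T p
    rw [gnLoop_cons, List.length_cons]
    push_cast
    split_ifs with hend
    · refine ⟨p, h, hloc, ?_⟩
      have hrem : (T : ℝ) - s.time ≤
          (batchBalls q Δ T ch m s).length * pullsPerBall lam Δ q (doublingDim X) T m := by
        rw [batchEnd] at hend
        have : (T : ℝ) ≤ s.time +
            (batchBalls q Δ T ch m s).length * pullsPerBall lam Δ q (doublingDim X) T m := by
          exact_mod_cast hend
        linarith
      have h1 : (T - s.time : ℝ) * (lossFactor lam L q * s.rad ^ q) ≤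
          batchRegret lam L q Δ (doublingDim X) J T :=
        (mul_le_mul_of_nonneg_right hrem (by positivity)).trans hcost
      have h2 : 0 ≤ (ms.length : ℝ) * batchRegret lam L q Δ (doublingDim X) J T := by positivity
      linarith
    · have hend' := not_le.1 hend
      rw [List.getLast?_cons_cons] at hlast
      obtain ⟨p', hp', hl', hle⟩ := ih
        (h.next (loss := fun t x => f x + e t) hX hf.lam_pos hf.lam_le hΔ hT hms.1 hend')
        (h.isLocalized_next hloc hf hgood hX hΔ hT hms.1 hend') hms.2 hlast
      refine ⟨p', hp', hl', hle.trans ?_⟩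
      have := h.listRegret_next_le (ch := ch) hloc hf hX hΔ hms.1 fun t x => f x + e t
      linarith

lemma regret_gnArm_le (hX : IsDoublingSpace X) (hdiam : Metric.diam (Set.univ : Set X) ≤ Δ)
    (hf : IsNondegenerate f xs lam L q) (hgood : NoiseGood T e)
    (hΔ : 0 < Δ) (hT : 2 ≤ T) {J : ℕ} (hJ : radiusFactor lam L q ≤ 2 ^ J) :
    regret f xs T (gnArm lam L q Δ T (halfBatches q (doublingDim X) T) ch
        fun t x => f x + e t) ≤
      2 * halfBatches q (doublingDim X) T * batchRegret lam L q Δ (doublingDim X) J T +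
        lossFactor lam L q * (Δ ^ q * Real.exp 1 * Real.sqrt (T * Real.log T)) := by
  have : Nonempty X := ⟨xs⟩
  have hd := doublingDim_nonneg hX
  have hD := lossFactor_pos hf.lam_pos hf.lam_le q
  have hbr := batchRegret_nonneg (q := q) hf.lam_pos hf.lam_le hΔ (doublingDim X) J T
  set M := halfBatches q (doublingDim X) T
  obtain ⟨hchain, hlast⟩ := batchIndices_spec hΔ hf.one_le hd hT M
  have hloc : IsLocalized lam L q xs
      { time := 0, rad := Δ, region := (Set.univ : Set X), arms := [], points := [0] } := by
    refine ⟨Set.mem_univ _, fun y _ => ?_⟩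
    have h1 := (Metric.dist_le_diam_of_mem isCompact_univ.isBounded (Set.mem_univ y)
      (Set.mem_univ xs)).trans hdiam
    have h2 : 1 ≤ 3 + 2 * ((lam + L) / lam) ^ (1 / q) := by
      have := three_le_threshold hf.lam_pos hf.lam_le q
      linarith
    exact h1.trans (le_mul_of_one_le_left hΔ.le h2)
  have hBlast := mul_le_mul_of_nonneg_left
    (mul_roundedRadius_last_le hΔ hf.one_le hd hT) hD.le
  rw [mul_left_comm] at hBlast
  obtain ⟨p, hp, hFloc, hle⟩ := gnLoop_regret_le (ch := ch) (isReachable_start hT) hloc hf hgood hX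
    hΔ hT hJ hchain hlast (by positivity) hBlast
  have hlen : ((batchIndices Δ q (doublingDim X) T M).length : ℝ) ≤ 2 * M := by
    exact_mod_cast length_batchIndices_le Δ q (doublingDim X) T M
  have hlen' := mul_le_mul_of_nonneg_right hlen hbr
  simp only [listRegret, List.map_nil, List.sum_nil, zero_add] at hle
  refine le_trans ?_ (hle.trans (by linarith))
  simp only [regret, gnArm]
  change ∑ t ∈ Finset.range T, (f ((gnFinal lam L q Δ T M ch _).arms.getD t _) - f xs) ≤
    ((gnFinal lam L q Δ T M ch fun t x => f x + e t).arms.map fun x => f x - f xs).sum +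
      (T - (gnFinal lam L q Δ T M ch fun t x => f x + e t).time) *
        (lossFactor lam L q * (gnFinal lam L q Δ T M ch fun t x => f x + e t).rad ^ q)
  change IsReachable q Δ T (gnFinal lam L q Δ T M ch fun t x => f x + e t) p at hp
  change IsLocalized lam L q xs (gnFinal lam L q Δ T M ch fun t x => f x + e t) at hFloc
  set F := gnFinal lam L q Δ T M ch fun t x => f x + e t
  have hrad : 0 ≤ F.rad := (hp.rad_eq ▸ roundedRadius_pos hΔ q (doublingDim X) T p).le
  rw [← Finset.sum_range_add_sum_Ico _ hp.time_lt.le, ← hp.length_arms,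
    sum_range_getD F.arms (fun t => ch.clean t F.region) fun x => f x - f xs]
  gcongr
  refine (Finset.sum_le_card_nsmul _ _ (lossFactor lam L q * F.rad ^ q) fun t ht => ?_).trans_eq ?_
  · rw [List.getD_eq_default _ _ (Finset.mem_Ico.1 ht).1]
    exact hFloc.value_le hf hrad (ch.clean_spec t _ hp.nonempty)
  · rw [Nat.card_Ico, nsmul_eq_mul, Nat.cast_sub (hp.length_arms ▸ hp.time_lt.le)]

end Regret

/-! ### Numerical bounds and the main estimate -/

lemma one_lt_log_three : 1 < Real.log 3 := by
  rw [Real.lt_log_iff_exp_lt (by norm_num)]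
  linarith [Real.exp_one_lt_d9]

lemma log_log_three_pos : 0 < Real.log (Real.log 3) := Real.log_pos one_lt_log_three

lemma log_log_bounds {T : ℕ} (hT : 3 ≤ T) :
    Real.log (Real.log (T / Real.log T)) ≤ Real.log (Real.log T) ∧
      Real.log (Real.log 3) ≤ Real.log (Real.log T) := by
  have hT' : (3 : ℝ) ≤ T := by exact_mod_cast hT
  have h3 := one_lt_log_three
  have h4 : Real.log 3 ≤ Real.log T := Real.log_le_log (by norm_num) hT'
  have h5 := one_lt_log_div_log (T := T) (by omega)
  refine ⟨Real.log_le_log (by linarith) (Real.log_le_log ?_ ?_), Real.log_le_log (by linarith) h4⟩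
  · exact div_pos (by linarith) (by linarith)
  · exact div_le_self (by linarith) (by linarith)

lemma add_one_le_three_rpow {d : ℝ} (hd : 0 ≤ d) : d + 1 ≤ (3 : ℝ) ^ d := by
  refine (Real.add_one_le_exp d).trans ?_
  rw [← Real.exp_one_rpow]
  exact Real.rpow_le_rpow (Real.exp_pos 1).le (by linarith [Real.exp_one_lt_d9]) hd

theorem theorem1 (lam L q Δ : ℝ) (hlam : 0 < lam) (hL : lam ≤ L) (hq : 1 ≤ q) (hΔ : 0 < Δ) :
    ∃ K A C : ℝ, 0 < K ∧ 0 < A ∧ 0 < C ∧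
      ∀ (X : Type*) [MetricSpace X] [CompactSpace X], IsDoublingSpace X →
        Metric.diam (Set.univ : Set X) ≤ Δ →
      ∀ (f : X → ℝ) (xs : X), IsNondegenerate f xs lam L q →
      ∀ (ch : GNChoices X) (T : ℕ), 2 ≤ T →
        -- the algorithm is a batched procedure with an adaptive grid
        IsBatchedRun T (gnArm lam L q Δ T (halfBatches q (doublingDim X) T) ch)
          (gnGrid lam L q Δ T (halfBatches q (doublingDim X) T) ch) ∧
        -- it uses `O(log log T)` communication points, whatever the losses are
        (3 ≤ T → ∀ loss : ℕ → X → ℝ,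
          ((gnGrid lam L q Δ T (halfBatches q (doublingDim X) T) ch loss).length : ℝ) ≤
            C * (doublingDim X + 1) * Real.log (Real.log T)) ∧
        -- with probability exceeding `1 - 2 / T`, its regret is small
        ∀ (Ω : Type*) [MeasurableSpace Ω] (μ : Measure Ω) [IsProbabilityMeasure μ]
          (ε : ℕ → Ω → ℝ), IsSubgaussianNoise μ ε →
          ∃ E : Set Ω, MeasurableSet E ∧ 1 - 2 / (T : ℝ) < μ.real E ∧
            ∀ ω ∈ E,
              regret f xs T (gnArm lam L q Δ T (halfBatches q (doublingDim X) T) ch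
                (fun t x => f x + ε t ω)) ≤
              K * A ^ doublingDim X * Real.sqrt (T * Real.log T) *
                Real.log (Real.log (T / Real.log T)) := by
  obtain ⟨c₀, hc₀, hc₀T⟩ := exists_le_log_log_div_log
  obtain ⟨J, hJ⟩ := pow_unbounded_of_one_lt (radiusFactor lam L q) (one_lt_two (α := ℝ))
  have hg : 0 < Real.log (Real.log 3) := log_log_three_pos
  have hD := lossFactor_pos hlam hL q
  have hP := pullsFactor_pos hlam hΔ q
  -- `2 M ≤ (4 + 2 / c₀) 3 ^ d log log (T / log T)` batches cost at most `b (2 ^ (J + 1)) ^ d` each,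
  -- and the cleanup costs `b'`, both in units of `√(T log T)`. Since `log log (T / log T) ≥ c₀`, the
  -- additive constants are absorbed by the factor `log log (T / log T)`.
  set b := pullsFactor lam Δ q * lossFactor lam L q * (4 ^ q / Δ ^ q) with hb
  set b' := lossFactor lam L q * (Δ ^ q * Real.exp 1) with hb'
  refine ⟨(4 + 2 / c₀) * b + b' / c₀, 3 * 2 ^ (J + 1), 4 + 4 / Real.log (Real.log 3),
    by positivity, by positivity, by positivity, ?_⟩
  intro X _ _ hX hdiam f xs hf ch T hT
  have : Nonempty X := ⟨xs⟩
  have hd := doublingDim_nonneg hX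
  have hLL := log_log_div_log_nat_pos hT
  have hM := halfBatches_le hq hd hT
  refine ⟨isBatchedRun_gnArm hX hlam hL hq hΔ hT _, fun hT3 loss => ?_, ?_⟩
  · have h1 : ((gnGrid lam L q Δ T (halfBatches q (doublingDim X) T) ch loss).length : ℝ) ≤
        2 * halfBatches q (doublingDim X) T + 2 := by exact_mod_cast length_gnGrid_le _
    obtain ⟨h2, h3⟩ := log_log_bounds hT3
    set d := doublingDim X
    set g := Real.log (Real.log 3)
    set G := Real.log (Real.log T)
    have h4 := mul_le_mul_of_nonneg_left h2 (show 0 ≤ d + 2 by linarith)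
    have h5 : 4 ≤ 4 / g * G := by
      rw [div_mul_eq_mul_div, le_div_iff₀ hg]
      linarith
    have h6 : 0 ≤ d * (4 / g * G) := by
      have : 0 < G := hg.trans_le h3
      positivity
    have h7 : 0 ≤ d * G := mul_nonneg hd (hg.le.trans h3)
    linarith
  · intro Ω _ μ _ ε hε
    refine ⟨{ω | NoiseGood T fun t => ε t ω}, measurableSet_noiseGood hε T,
      lt_measureReal_noiseGood hε hT, fun ω hω => ?_⟩
    have hgood : NoiseGood T fun t => ε t ω := hω
    refine (regret_gnArm_le hX hdiam hf hgood hΔ hT hJ.le).trans ?_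
    have hc := hc₀T T hT
    rw [batchRegret, ← hb]
    set d := doublingDim X
    set G := Real.log (Real.log (T / Real.log T))
    set S := Real.sqrt (T * Real.log T)
    have hS : 0 ≤ S := Real.sqrt_nonneg _
    have hA : ((3 : ℝ) * 2 ^ (J + 1)) ^ d = 3 ^ d * (2 ^ (J + 1)) ^ d :=
      Real.mul_rpow (by norm_num) (by positivity)
    have hA1 : 1 ≤ ((2 : ℝ) ^ (J + 1)) ^ d :=
      Real.one_le_rpow (one_le_pow₀ one_le_two) hd
    have h3 := add_one_le_three_rpow hd
    have h31 : (1 : ℝ) ≤ 3 ^ d := by linarith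
    have h1 : 1 ≤ G / c₀ := (one_le_div hc₀).2 hc
    have h2M : 2 * (halfBatches q d T : ℝ) ≤ (4 + 2 / c₀) * (3 ^ d * G) := by
      have e1 : (d + 2) * G ≤ 2 * 3 ^ d * G := by
        gcongr
        linarith
      have e2 : G / c₀ ≤ 3 ^ d * (G / c₀) := le_mul_of_one_le_left (by positivity) h31
      have e3 : 2 / c₀ * (3 ^ d * G) = 2 * (3 ^ d * (G / c₀)) := by ring
      linarith
    have hb0 : 0 ≤ b := by positivity
    have hb0' : 0 ≤ b' := by positivity
    have f1 : 2 * (halfBatches q d T : ℝ) * (b * (2 ^ (J + 1)) ^ d * S) ≤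
        (4 + 2 / c₀) * (3 ^ d * G) * (b * (2 ^ (J + 1)) ^ d * S) := by gcongr
    have f2 : b' * S * 1 ≤ b' * S * (3 ^ d * (2 ^ (J + 1)) ^ d * (G / c₀)) := by
      gcongr
      exact one_le_mul_of_one_le_of_one_le (one_le_mul_of_one_le_of_one_le h31 hA1) h1
    calc _ = 2 * (halfBatches q d T : ℝ) * (b * (2 ^ (J + 1)) ^ d * S) + b' * S * 1 := by
          rw [hb']
          ring
      _ ≤ (4 + 2 / c₀) * (3 ^ d * G) * (b * (2 ^ (J + 1)) ^ d * S) +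
          b' * S * (3 ^ d * (2 ^ (J + 1)) ^ d * (G / c₀)) := add_le_add f1 f2
      _ = _ := by
          rw [hA]
          ring
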